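/- Let $\mathbb N=\{0,1,2,\dots\}$ and let $a,c$ be real numbers with $a\neq 0,1$ and $c\notin\{0,-1,-2,\dots\}$. The Meixner polynomials are $$m_n^{a,c}(x)=\frac{a^n}{(1-a)^n}\sum_{j=0}^n a^{-j}\binom{x}{j}\binom{-x-c}{n-j}\quad(n\ge 0),\qquad m_n^{a,c}=0\quad (n<0).$$ Let $F=(F_1,F_2)$ be a pair of finite sets of positive integers, not both empty, let $k_i$ be the number of elements of $F_i$, $k=k_1+k_2$, and put $$u_F=\sum_{f\in F_1}f+\sum_{f\in F_2}f-\binom{k_1+1}{2}-\binom{k_2}{2},\qquad w_F=\sum_{f\in F_1}f+\sum_{f\in F_2}f-\binom{k_1}{2}-\binom{k_2}{2}+1 .$$ For $n\in\mathbb Z$ let $m_n^{a,c;F}(x)$ be the $(k+1)\times(k+1)$ determinant whose first row is $\big(m^{a,c}_{n-u_F}(x+l)\big)_{0\le l\le k}$, followed by the rows $\big(m^{a,c}_{f}(x+l)\big)_{0\le l\le k}$ for $f\in F_1$ in increasing order, and then by the rows $\big(m^{1/a,c}_{f}(x+l)/a^{l}\big)_{0\le l\le k}$ for $f\in F_2$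 in increasing order. Let $\Omega_F^{a,c}(x)$ be the $k\times k$ determinant with the rows $\big(m^{a,c}_{f}(x+l)\big)_{0\le l\le k-1}$, $f\in F_1$, followed by the rows $\big(m^{1/a,c}_{f}(x+l)/a^{l}\big)_{0\le l\le k-1}$, $f\in F_2$ (these definitions of $k$ and $\Omega_F^{a,c}$ apply to every pair of finite sets of positive integers and every real second parameter). For a non-empty finite set $S$ of positive integers put $I(S)=\{1,2,\dots,\max S\}\setminus\{\max S-f: f\in S\}$, and put $I(\emptyset)=\emptyset$, $\max\emptyset=-1$. Let $G=(I(F_1),I(F_2))$. Then there is a polynomial $\lambda_F^{a,c}$ (determined up to an additive constant) with $$\lambda_F^{a,c}(x)-\lambda_F^{a,c}(x-1)=\Omega_G^{a,\,-c-\max F_1-\max F_2}(-x),$$ and every such polynomial $\lambda_F^{a,c}$ has degree $w_F$ and satisfies the following: there are coefficients $A_j(n)$ $(-w_F\le j\le w_F,\ n\in\mathbb N)$, independent of $x$, such that $$\sum_{j=-w_F}^{w_F}A_j(n)\,m_{n+j}^{a,c;F}(x)=\lambda_F^{a,c}(x)\,m_n^{a,c;F}(x),\qquad n\ge 0;$$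 each $A_j$ is a rational function of $n$ whose denominator does not vanish at any $n\in\mathbb N$; and $A_{w_F}(n)\ne 0$ for all sufficiently large $n$ (so the recurrence has order $2w_F+1$). -/

import Mathlib

open Polynomial

namespace ExceptionalMeixner

/-- The binomial coefficient `binom(x, j) = x (x - 1) ⋯ (x - j + 1) / j!`, as a polynomial in `x`. -/
noncomputable def binomPoly (j : ℕ) : ℝ[X] :=
  C ((j.factorial : ℝ)⁻¹) * descPochhammer ℝ j

/-- The Meixner polynomial
`m_n^{a,c}(x) = (a / (1 - a))^n ∑_{j=0}^n a^{-j} binom(x, j) binom(-x - c, n - j)`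
of natural index `n`. -/
noncomputable def meixnerNat (a c : ℝ) (n : ℕ) : ℝ[X] :=
  C ((a / (1 - a)) ^ n) *
    ∑ j ∈ Finset.range (n + 1),
      C ((a ^ j)⁻¹) * (binomPoly j * (binomPoly (n - j)).comp (-X - C c))

/-- The Meixner polynomial `m_n^{a,c}` of integer index, equal to `0` for `n < 0`. -/
noncomputable def meixner (a c : ℝ) (n : ℤ) : ℝ[X] :=
  if n < 0 then 0 else meixnerNat a c n.toNat

/-- The shift `p(x) ↦ p(x + l)`. -/
noncomputable def shift (l : ℕ) (p : ℝ[X]) : ℝ[X] :=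
  p.comp (X + C (l : ℝ))

/-- The number
`u_F = ∑_{f ∈ F₁} f + ∑_{f ∈ F₂} f - binom(k₁ + 1, 2) - binom(k₂, 2)`. -/
def u (F₁ F₂ : Finset ℕ) : ℤ :=
  ∑ f ∈ F₁, (f : ℤ) + ∑ f ∈ F₂, (f : ℤ)
    - ((F₁.card + 1).choose 2 : ℤ) - (F₂.card.choose 2 : ℤ)

/-- The number
`w_F = ∑_{f ∈ F₁} f + ∑_{f ∈ F₂} f - binom(k₁, 2) - binom(k₂, 2) + 1`. -/
def w (F₁ F₂ : Finset ℕ) : ℤ :=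
  ∑ f ∈ F₁, (f : ℤ) + ∑ f ∈ F₂, (f : ℤ)
    - (F₁.card.choose 2 : ℤ) - (F₂.card.choose 2 : ℤ) + 1

/-- The `i`-th element, in increasing order, of a finite set of natural numbers. -/
def elt (F : Finset ℕ) (i : Fin F.card) : ℕ := F.orderEmbOfFin rfl i

/-- The rows indexed by `F₁` and then by `F₂` (each in increasing order): the entry in column `l`
is `m_f^{a,c}(x + l)` for `f ∈ F₁`, and `m_f^{1/a,c}(x + l) / a^l` for `f ∈ F₂`. -/
noncomputable def rows (a c : ℝ) (F₁ F₂ : Finset ℕ) : Fin (F₁.card + F₂.card) → ℕ → ℝ[X] :=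
  Fin.append
    (fun i l => shift l (meixner a c (elt F₁ i)))
    (fun i l => C ((a ^ l)⁻¹) * shift l (meixner (1 / a) c (elt F₂ i)))

/-- The polynomial `m_n^{a,c;F}`, `F = (F₁, F₂)`: the determinant of size `k + 1` whose first row
is `m_{n - u_F}^{a,c}(x + l)`, `0 ≤ l ≤ k`, followed by the rows of `F₁` and `F₂`. -/
noncomputable def exceptional (a c : ℝ) (F₁ F₂ : Finset ℕ) (n : ℤ) : ℝ[X] :=
  Matrix.det (Matrix.of fun i l : Fin (F₁.card + F₂.card + 1) =>
    (Fin.cons (fun l' : ℕ => shift l' (meixner a c (n - u F₁ F₂))) (rows a c F₁ F₂) :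
      Fin (F₁.card + F₂.card + 1) → ℕ → ℝ[X]) i l)

/-- The Casoratian type determinant `Ω_F^{a,c}`, `F = (F₁, F₂)`, of size `k = k₁ + k₂`. -/
noncomputable def casoratian (a c : ℝ) (F₁ F₂ : Finset ℕ) : ℝ[X] :=
  Matrix.det (Matrix.of fun i l : Fin (F₁.card + F₂.card) => rows a c F₁ F₂ i l)

/-- The involution `I(F) = {1, …, max F} \ {max F - f : f ∈ F}`, with `I(∅) = ∅`. -/
def invol (F : Finset ℕ) : Finset ℕ :=
  Finset.Icc 1 (F.sup id) \ F.image (fun f => F.sup id - f)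

/-- The maximum of a finite set of natural numbers, with the convention `max ∅ = -1`. -/
def maxInt (F : Finset ℕ) : ℤ :=
  if F.Nonempty then ((F.sup id : ℕ) : ℤ) else -1

/-- `lam` is a solution (there is exactly one up to an additive constant) of
`λ(x) - λ(x - 1) = Ω_G^{a, -c - max F₁ - max F₂}(-x)`, where `G = (I(F₁), I(F₂))`. -/
def IsLambda (a c : ℝ) (F₁ F₂ : Finset ℕ) (lam : ℝ[X]) : Prop :=
  lam - lam.comp (X - 1) =
    (casoratian a (-c - (maxInt F₁ : ℝ) - (maxInt F₂ : ℝ)) (invol F₁) (invol F₂)).comp (-X)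

end ExceptionalMeixner

/-!
Write `α = 1 / (1 - a)` and `β = a / (1 - a)`, so that `α - β = 1`. The Meixner polynomials have the
generating function `G(z, x) = (1 + α z)^x (1 + β z)^(-x - c)`; a translation of `x` multiplies it
by `(1 + α z) / (1 + β z)` (`meixner_shift`), and multiplication by `x` is a differential operator
in `z`, that is, a recurrence operator in `n` with polynomial coefficients (`X_mul_meixner`). The
expansion of `G` at `z = ∞` has as coefficients the polynomials with first parameter `1 / a`, times
`a^(-x)`, and satisfies the same relations with `n` replaced by `n - c`.

The exceptional polynomial of index `n` is `D m_{n - u_F}`, where `D` is the Casoratian operator of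
the rows of `F`, which annihilates these rows. Let the difference of `λ` be a multiple of the
Casoratian `Ω_F`. Variation of constants applied to the formal function `S^x` shows that `λ D` equals
`D` composed with a difference operator whose coefficients are polynomials in `x` and rational
functions of `S`, with poles only at `S = 1` and `S = 1 / a` and bounded at `S = ∞`
(`exists_intertwiner`). These rational functions are exactly the Laurent polynomials in `z` when
`S = (1 + α z) / (1 + β z)`, so on the generating function they act as recurrence operators
(`exists_recurrence`); thus the coefficients `A_j` are in fact polynomials in `n`. Comparing degrees
along the expansions at `z = 0` and at `z = ∞` shows that `A_j = 0` for `j > deg λ` and for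
`j < -deg λ` respectively, and that `A_j` is eventually nonzero for `j = deg λ`.

Two facts about Casoratians complete the argument. The degree of a Casoratian of rows with twists `1`
and `1 / a` is the expected one, because after a change of columns the top coefficient is a product
of two Vandermonde determinants (`casoratian_ne_zero_and_natDegree`). The Casoratian of `I(F)` in the
definition of `λ` is a nonzero multiple of `Ω_F` after reflection: the matrix of all rows of index at
most `max F₁` and `max F₂` pairs with the matrix of the same kind for the parameter
`-c - max F₁ - max F₂` at `-x` to a triangular Hankel matrix of constants, and the two Casoratians are
complementary minors (`exists_casoratian_invol`).
-/

namespace ExceptionalMeixner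

/-! ### Generating functions -/

lemma binomPoly_zero : binomPoly 0 = 1 := by simp [binomPoly]

lemma binomPoly_succ_mul (j : ℕ) :
    C ((j : ℝ) + 1) * binomPoly (j + 1) = (X - C (j : ℝ)) * binomPoly j := by
  have h : ((j : ℝ) + 1) ≠ 0 := by positivity
  have h' : (j.factorial : ℝ) ≠ 0 := by positivity
  have e : ((j : ℝ) + 1) * (((j + 1).factorial : ℝ))⁻¹ = ((j.factorial : ℝ))⁻¹ := by
    rw [Nat.factorial_succ]; push_cast; field_simp
  rw [binomPoly, binomPoly, ← mul_assoc, ← C_mul, e, descPochhammer_succ_right, C_eq_natCast]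
  ring

lemma binomPoly_succ_comp (j : ℕ) :
    (binomPoly (j + 1)).comp (X + 1) = binomPoly (j + 1) + binomPoly j := by
  have h' : (j.factorial : ℝ) ≠ 0 := by positivity
  have e : (((j + 1).factorial : ℝ))⁻¹ * ((j : ℝ) + 1) = ((j.factorial : ℝ))⁻¹ := by
    rw [Nat.factorial_succ]; push_cast; field_simp
  have h1 : (descPochhammer ℝ (j + 1)).comp (X + 1) = (X + 1) * descPochhammer ℝ j := by
    rw [descPochhammer_succ_left, mul_comp, comp_assoc]; simp
  rw [binomPoly, binomPoly, mul_comp, h1, C_comp, ← e, descPochhammer_succ_right, C_mul,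
    map_add, C_eq_natCast, map_one]
  ring

/-- The binomial series `(1 + γ z)^y`, with exponent a polynomial `y`, as a power series in `z`. -/
noncomputable def binomSeries (γ : ℝ) (y : ℝ[X]) : PowerSeries ℝ[X] :=
  PowerSeries.mk fun j => C (γ ^ j) * (binomPoly j).comp y

/-- The linear power series `1 + γ z`. -/
noncomputable def linSeries (γ : ℝ) : PowerSeries ℝ[X] :=
  1 + PowerSeries.C (C γ) * PowerSeries.X

lemma binomSeries_add_one (γ : ℝ) (y : ℝ[X]) :
    binomSeries γ (y + 1) = linSeries γ * binomSeries γ y := by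
  ext1 n
  rw [linSeries, add_mul, one_mul, mul_assoc, map_add, PowerSeries.coeff_C_mul]
  cases n with
  | zero => simp [binomSeries, binomPoly_zero]
  | succ n =>
    rw [PowerSeries.coeff_succ_X_mul]
    have h := congrArg (fun p => p.comp y) (binomPoly_succ_comp n)
    simp only [comp_assoc, add_comp, X_comp, one_comp] at h
    simp only [binomSeries, PowerSeries.coeff_mk, h, pow_succ, C_mul]
    ring

lemma linSeries_mul_derivative_binomSeries (γ : ℝ) (y : ℝ[X]) :
    linSeries γ * PowerSeries.derivative ℝ[X] (binomSeries γ y) =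
      PowerSeries.C (C γ * y) * binomSeries γ y := by
  ext1 n
  have h := fun n => congrArg (fun p => p.comp y) (binomPoly_succ_mul n)
  simp only [mul_comp, sub_comp, X_comp, C_comp] at h
  rw [linSeries, add_mul, one_mul, mul_assoc, map_add, PowerSeries.coeff_C_mul,
    PowerSeries.coeff_C_mul]
  have h' := h n
  simp only [map_add, map_one, map_natCast] at h'
  cases n with
  | zero =>
    simp only [PowerSeries.coeff_zero_X_mul, PowerSeries.coeff_derivative, binomSeries,
      PowerSeries.coeff_mk]
    simp only [CharP.cast_eq_zero, zero_add, one_mul, sub_zero, binomPoly_zero, one_comp,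
      mul_one, pow_one, pow_zero, map_one] at h' ⊢
    rw [h']
    ring
  | succ n =>
    rw [PowerSeries.coeff_succ_X_mul]
    simp only [PowerSeries.coeff_derivative, binomSeries, PowerSeries.coeff_mk, pow_succ, C_mul]
    push_cast at h' ⊢
    linear_combination C (γ ^ n) * C γ * C γ * h'

lemma derivative_mul_eq {R : Type*} [CommRing R] (f g : PowerSeries R) :
    PowerSeries.derivative R (f * g) =
      f * PowerSeries.derivative R g + g * PowerSeries.derivative R f := by
  rw [Derivation.leibniz, smul_eq_mul, smul_eq_mul]

/-- A solution of `(1 + γ z) f' = γ y f` is determined by its constant term. -/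
lemma eq_of_linSeries_mul_derivative (γ : ℝ) (y : ℝ[X]) (f g : PowerSeries ℝ[X])
    (hf : linSeries γ * PowerSeries.derivative ℝ[X] f = PowerSeries.C (C γ * y) * f)
    (hg : linSeries γ * PowerSeries.derivative ℝ[X] g = PowerSeries.C (C γ * y) * g)
    (h0 : PowerSeries.coeff 0 f = PowerSeries.coeff 0 g) : f = g := by
  have key : ∀ f : PowerSeries ℝ[X],
      linSeries γ * PowerSeries.derivative ℝ[X] f = PowerSeries.C (C γ * y) * f → ∀ n : ℕ,
      PowerSeries.coeff (n + 1) f * ((n : ℝ[X]) + 1) =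
        C γ * (y - n) * PowerSeries.coeff n f := by
    intro f hf n
    have h := congrArg (PowerSeries.coeff n) hf
    rw [linSeries, add_mul, one_mul, mul_assoc, map_add, PowerSeries.coeff_C_mul,
      PowerSeries.coeff_C_mul] at h
    cases n with
    | zero =>
      simp only [PowerSeries.coeff_zero_X_mul, PowerSeries.coeff_derivative] at h
      simp at h ⊢
      linear_combination h
    | succ n =>
      rw [PowerSeries.coeff_succ_X_mul] at h
      simp only [PowerSeries.coeff_derivative] at h
      push_cast at h ⊢
      linear_combination h
  ext1 n
  induction n with
  | zero => exact h0
  | succ n ih =>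
    have h := (key f hf n).trans ((congrArg _ ih).trans (key g hg n).symm)
    exact mul_right_cancel₀ (by exact_mod_cast Nat.succ_ne_zero n) h

/-- The Vandermonde convolution, in the form `(1 + γ z)^(y + y') = (1 + γ z)^y (1 + γ z)^y'`. -/
lemma binomSeries_add (γ : ℝ) (y y' : ℝ[X]) :
    binomSeries γ (y + y') = binomSeries γ y * binomSeries γ y' := by
  refine eq_of_linSeries_mul_derivative γ (y + y') _ _
    (linSeries_mul_derivative_binomSeries _ _) ?_ ?_
  · have h1 := linSeries_mul_derivative_binomSeries γ y
    have h2 := linSeries_mul_derivative_binomSeries γ y'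
    rw [derivative_mul_eq, mul_add, mul_add, map_add]
    linear_combination binomSeries γ y * h2 + binomSeries γ y' * h1
  · simp [binomSeries, binomPoly_zero]

/-- The series `(1 + α z)^y (1 + β z)^(-y - c)`. For `α = 1 / (1 - a)` and `β = a / (1 - a)` it
generates the Meixner polynomials in the variable `y`. -/
noncomputable def genSeries (α β c : ℝ) (y : ℝ[X]) : PowerSeries ℝ[X] :=
  binomSeries α y * binomSeries β (-y - C c)

lemma genSeries_add_one (α β c : ℝ) (y : ℝ[X]) :
    linSeries β * genSeries α β c (y + 1) = linSeries α * genSeries α β c y := by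
  have h : -y - C c = (-(y + 1) - C c) + 1 := by ring
  rw [genSeries, genSeries, binomSeries_add_one, h, binomSeries_add_one]
  ring

lemma genSeries_sub_one_add_one (α β c : ℝ) (y : ℝ[X]) :
    genSeries α β (c - 1) (y + 1) = linSeries α * genSeries α β c y := by
  have h : -(y + 1) - C (c - 1) = -y - C c := by rw [map_sub, map_one]; ring
  rw [genSeries, genSeries, binomSeries_add_one, h]
  ring

lemma genSeries_sub_one (α β c : ℝ) (y : ℝ[X]) :
    genSeries α β (c - 1) y = linSeries β * genSeries α β c y := by
  have h : -y - C (c - 1) = (-y - C c) + 1 := by rw [map_sub, map_one]; ring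
  rw [genSeries, genSeries, h, binomSeries_add_one]
  ring

lemma genSeries_mul (α β c c' : ℝ) (y y' : ℝ[X]) :
    genSeries α β c y * genSeries α β c' y' = genSeries α β (c + c') (y + y') := by
  have h : -(y + y') - C (c + c') = (-y - C c) + (-y' - C c') := by rw [map_add]; ring
  rw [genSeries, genSeries, genSeries, h, binomSeries_add, binomSeries_add]
  ring

lemma linSeries_mul_derivative_genSeries (α β c : ℝ) (hαβ : α - β = 1) (y : ℝ[X]) :
    linSeries α * (linSeries β * PowerSeries.derivative ℝ[X] (genSeries α β c y)) =
      (PowerSeries.C y - PowerSeries.C (C (c * β)) * linSeries α) * genSeries α β c y := by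
  have h1 := linSeries_mul_derivative_binomSeries α y
  have h2 := linSeries_mul_derivative_binomSeries β (-y - C c)
  rw [genSeries, derivative_mul_eq]
  have e : PowerSeries.C y = PowerSeries.C (C α * y) - PowerSeries.C (C β * y) := by
    rw [← map_sub, ← sub_mul, ← C_sub, hαβ]; simp
  have e2 : PowerSeries.C (C β * (-y - C c)) =
      - PowerSeries.C (C β * y) - PowerSeries.C (C (c * β)) := by
    rw [← map_neg, ← map_sub, C_mul]; congr 1; ring
  have e3 : PowerSeries.C (C α * y) * linSeries β - PowerSeries.C (C β * y) * linSeries α =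
      PowerSeries.C y := by
    rw [linSeries, linSeries, e]
    simp only [map_mul]
    ring
  rw [e2] at h2
  linear_combination linSeries β * binomSeries β (-y - C c) * h1 +
    linSeries α * binomSeries α y * h2 + binomSeries α y * binomSeries β (-y - C c) * e3

/-- The coefficient of `z^n` for an integer `n`, equal to `0` for `n < 0`. -/
noncomputable def intCoeff (f : PowerSeries ℝ[X]) (n : ℤ) : ℝ[X] :=
  if n < 0 then 0 else PowerSeries.coeff n.toNat f

lemma intCoeff_natCast (f : PowerSeries ℝ[X]) (n : ℕ) :
    intCoeff f n = PowerSeries.coeff n f := by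
  simp [intCoeff]

lemma intCoeff_negSucc (f : PowerSeries ℝ[X]) (n : ℕ) : intCoeff f (Int.negSucc n) = 0 := by
  simp [intCoeff, Int.negSucc_lt_zero]

lemma intCoeff_of_neg (f : PowerSeries ℝ[X]) {n : ℤ} (hn : n < 0) : intCoeff f n = 0 := by
  simp [intCoeff, hn]

lemma intCoeff_add (f g : PowerSeries ℝ[X]) (n : ℤ) :
    intCoeff (f + g) n = intCoeff f n + intCoeff g n := by
  simp only [intCoeff]; split_ifs <;> simp

lemma intCoeff_C_mul (p : ℝ[X]) (f : PowerSeries ℝ[X]) (n : ℤ) :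
    intCoeff (PowerSeries.C p * f) n = p * intCoeff f n := by
  simp only [intCoeff]; split_ifs <;> simp

lemma intCoeff_X_mul (f : PowerSeries ℝ[X]) (n : ℤ) :
    intCoeff (PowerSeries.X * f) n = intCoeff f (n - 1) := by
  rcases n with (_ | n) | n
  · simp [intCoeff]
  · have h : (Int.ofNat (n + 1)) - 1 = (n : ℤ) := by simp
    rw [h, intCoeff_natCast, Int.ofNat_eq_natCast, intCoeff_natCast,
      PowerSeries.coeff_succ_X_mul]
  · rw [intCoeff_negSucc, intCoeff_of_neg]
    have := Int.negSucc_lt_zero n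
    omega

lemma intCoeff_linSeries_mul (γ : ℝ) (f : PowerSeries ℝ[X]) (n : ℤ) :
    intCoeff (linSeries γ * f) n = intCoeff f n + C γ * intCoeff f (n - 1) := by
  rw [linSeries, add_mul, one_mul, mul_assoc, intCoeff_add, intCoeff_C_mul, intCoeff_X_mul]

lemma intCoeff_derivative (f : PowerSeries ℝ[X]) (n : ℤ) :
    intCoeff (PowerSeries.derivative ℝ[X] f) n = C ((n : ℝ) + 1) * intCoeff f (n + 1) := by
  rcases n with n | n
  · have h : (Int.ofNat n) + 1 = ((n + 1 : ℕ) : ℤ) := by simp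
    rw [h, intCoeff_natCast, Int.ofNat_eq_natCast, intCoeff_natCast,
      PowerSeries.coeff_derivative]
    simp [mul_comm]
  · rw [intCoeff_negSucc]
    rcases n with _ | n
    · simp
    · rw [intCoeff_of_neg, mul_zero]
      rw [Int.negSucc_eq]; push_cast; omega

/-! ### Structure relations of the Meixner polynomials -/

lemma meixner_comp (a c : ℝ) (ha0 : a ≠ 0) (n : ℤ) (y : ℝ[X]) :
    (meixner a c n).comp y = intCoeff (genSeries (1 - a)⁻¹ (a / (1 - a)) c y) n := by
  rw [meixner, intCoeff]
  split_ifs with h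
  · simp
  generalize n.toNat = n
  rw [genSeries, PowerSeries.coeff_mul, Finset.Nat.sum_antidiagonal_eq_sum_range_succ_mk,
    meixnerNat, mul_comp, C_comp, ← coe_compRingHom_apply, map_sum, Finset.mul_sum]
  refine Finset.sum_congr rfl fun j hj => ?_
  obtain ⟨i, rfl⟩ := Nat.exists_eq_add_of_le (Nat.lt_succ_iff.mp (Finset.mem_range.mp hj))
  have e : (a / (1 - a)) ^ (j + i) * (a ^ j)⁻¹ = ((1 - a)⁻¹) ^ j * (a / (1 - a)) ^ i := by
    rw [pow_add, div_pow, inv_pow]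
    field_simp
  have e' := congrArg (C : ℝ → ℝ[X]) e
  simp only [C_mul] at e'
  simp only [coe_compRingHom_apply, mul_comp, C_comp, comp_assoc, binomSeries,
    PowerSeries.coeff_mk, sub_comp, neg_comp, X_comp, Nat.add_sub_cancel_left]
  linear_combination (binomPoly j).comp y * (binomPoly i).comp (-y - C c) * e'

lemma meixner_of_neg (a c : ℝ) {n : ℤ} (hn : n < 0) : meixner a c n = 0 := by
  simp [meixner, hn]

lemma meixner_eq_intCoeff (a c : ℝ) (ha0 : a ≠ 0) (n : ℤ) :
    meixner a c n = intCoeff (genSeries (1 - a)⁻¹ (a / (1 - a)) c X) n := by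
  rw [← meixner_comp a c ha0, comp_X]

lemma inv_sub_div {a : ℝ} (ha1 : a ≠ 1) : (1 - a)⁻¹ - a / (1 - a) = 1 := by
  have : 1 - a ≠ 0 := sub_ne_zero.mpr ha1.symm
  field_simp

/-- The shift relation `(1 + β z) G(x + 1) = (1 + α z) G(x)`, read off at `z^n`. -/
lemma meixner_shift (a c : ℝ) (ha0 : a ≠ 0) (n : ℤ) :
    (meixner a c n).comp (X + 1) + C (a / (1 - a)) * (meixner a c (n - 1)).comp (X + 1) =
      meixner a c n + C ((1 - a)⁻¹) * meixner a c (n - 1) := by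
  have h := congrArg (intCoeff · n) (genSeries_add_one (1 - a)⁻¹ (a / (1 - a)) c X)
  simp only [intCoeff_linSeries_mul, ← meixner_comp a c ha0, comp_X] at h
  exact h

/-- The three-term recurrence relation of the Meixner polynomials, valid for all integers `n`. -/
lemma X_mul_meixner (a c : ℝ) (ha0 : a ≠ 0) (ha1 : a ≠ 1) (n : ℤ) :
    X * meixner a c n = C ((n : ℝ) + 1) * meixner a c (n + 1) +
      C (((1 - a)⁻¹ + a / (1 - a)) * n + c * (a / (1 - a))) * meixner a c n +
      C ((1 - a)⁻¹ * (a / (1 - a)) * (n - 1 + c)) * meixner a c (n - 1) := by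
  have h := congrArg (intCoeff · n)
    (linSeries_mul_derivative_genSeries (1 - a)⁻¹ (a / (1 - a)) c (inv_sub_div ha1) X)
  have e : ∀ f : PowerSeries ℝ[X], ∀ p : ℝ[X], ∀ α : ℝ,
      (PowerSeries.C X - PowerSeries.C p * linSeries α) * f + PowerSeries.C p * (linSeries α * f)
        = PowerSeries.C X * f := fun f p α => by ring
  have h2 := congrArg (intCoeff · n) (e (genSeries (1 - a)⁻¹ (a / (1 - a)) c X)
    (C (c * (a / (1 - a)))) (1 - a)⁻¹)
  simp only [intCoeff_add, intCoeff_C_mul] at h2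
  simp only [intCoeff_linSeries_mul, intCoeff_derivative] at h h2
  rw [show n - 1 + 1 = n by ring, show n - 1 - 1 + 1 = n - 1 by ring] at h
  simp only [← meixner_eq_intCoeff a c ha0] at h h2
  push_cast at h
  simp only [map_add, map_mul, map_sub, map_one] at *
  linear_combination -h2 - h

/-- Lowering the parameter `c` together with a shift of the variable. -/
lemma meixner_sub_one_shift (a c : ℝ) (ha0 : a ≠ 0) (n : ℤ) :
    (meixner a (c - 1) n).comp (X + 1) =
      meixner a c n + C ((1 - a)⁻¹) * meixner a c (n - 1) := by
  have h := congrArg (intCoeff · n) (genSeries_sub_one_add_one (1 - a)⁻¹ (a / (1 - a)) c X)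
  simp only [intCoeff_linSeries_mul, ← meixner_comp a _ ha0, comp_X] at h
  exact h

lemma meixner_sub_one (a c : ℝ) (ha0 : a ≠ 0) (n : ℤ) :
    meixner a (c - 1) n = meixner a c n + C (a / (1 - a)) * meixner a c (n - 1) := by
  have h := congrArg (intCoeff · n) (genSeries_sub_one (1 - a)⁻¹ (a / (1 - a)) c X)
  simp only [intCoeff_linSeries_mul, ← meixner_comp a _ ha0, comp_X] at h
  exact h

/-- The addition formula: the polynomials `m_n^c` are of convolution type. -/
lemma sum_meixner_mul_meixner (a c c' : ℝ) (ha0 : a ≠ 0) (n : ℕ) (y y' : ℝ[X]) :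
    ∑ f ∈ Finset.range (n + 1), (meixner a c f).comp y * (meixner a c' (n - f : ℕ)).comp y' =
      (meixner a (c + c') n).comp (y + y') := by
  simp only [meixner_comp a _ ha0, ← genSeries_mul, intCoeff_natCast]
  rw [PowerSeries.coeff_mul, Finset.Nat.sum_antidiagonal_eq_sum_range_succ_mk]

lemma meixner_zero (a c : ℝ) : meixner a c 0 = 1 := by
  simp [meixner, meixnerNat, binomPoly_zero]

lemma natDegree_meixner_le_and_coeff (a c : ℝ) (ha0 : a ≠ 0) (ha1 : a ≠ 1) (n : ℕ) :
    (meixner a c n).natDegree ≤ n ∧ (meixner a c n).coeff n ≠ 0 := by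
  induction n using Nat.strong_induction_on with
  | _ n ih =>
  rcases n with _ | n
  · simp [meixner_zero]
  have h := X_mul_meixner a c ha0 ha1 n
  obtain ⟨h1, h2⟩ := ih n (Nat.lt_succ_self n)
  have h3 : (meixner a c ((n : ℤ) - 1)).natDegree ≤ n := by
    rcases n with _ | n
    · rw [meixner_of_neg _ _ (by simp)]; simp
    · have := (ih n (by omega)).1
      push_cast
      rw [add_sub_cancel_right]
      omega
  set γ := ((1 - a)⁻¹ + a / (1 - a)) * ((n : ℤ) : ℝ) + c * (a / (1 - a))
  set δ := (1 - a)⁻¹ * (a / (1 - a)) * (((n : ℤ) : ℝ) - 1 + c)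
  have hn : (n : ℝ) + 1 ≠ 0 := by positivity
  have e : meixner a c ((n + 1 : ℕ) : ℤ) =
      C (((n : ℝ) + 1)⁻¹) * (X * meixner a c n - C γ * meixner a c n -
        C δ * meixner a c (n - 1)) := by
    rw [h]
    push_cast
    rw [← sub_eq_zero]
    have : (C (((n : ℝ) + 1)⁻¹) * C ((n : ℝ) + 1) : ℝ[X]) = 1 := by
      rw [← C_mul, inv_mul_cancel₀ hn, C_1]
    linear_combination (-meixner a c (n + 1)) * this
  have l1 : (C γ * meixner a c n).natDegree ≤ n := (natDegree_C_mul_le _ _).trans h1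
  have l2 : (C δ * meixner a c (n - 1)).natDegree ≤ n := (natDegree_C_mul_le _ _).trans h3
  constructor
  · rw [e]
    refine (natDegree_C_mul_le _ _).trans ?_
    refine (natDegree_sub_le_of_le (natDegree_sub_le_of_le (m := n + 1) (n := n + 1) ?_ (by omega))
      (n := n + 1) (by omega)).trans (by simp)
    refine natDegree_mul_le.trans ?_
    rw [natDegree_X]; omega
  · rw [e, coeff_C_mul, coeff_sub, coeff_sub, coeff_X_mul,
      coeff_eq_zero_of_natDegree_lt (lt_of_le_of_lt l1 (Nat.lt_succ_self n)),
      coeff_eq_zero_of_natDegree_lt (lt_of_le_of_lt l2 (Nat.lt_succ_self n)), sub_zero, sub_zero]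
    exact mul_ne_zero (inv_ne_zero hn) h2

lemma natDegree_meixner (a c : ℝ) (ha0 : a ≠ 0) (ha1 : a ≠ 1) (n : ℕ) :
    (meixner a c n).natDegree = n :=
  natDegree_eq_of_le_of_coeff_ne_zero (natDegree_meixner_le_and_coeff a c ha0 ha1 n).1
    (natDegree_meixner_le_and_coeff a c ha0 ha1 n).2

lemma meixner_ne_zero (a c : ℝ) (ha0 : a ≠ 0) (ha1 : a ≠ 1) (n : ℕ) : meixner a c n ≠ 0 :=
  fun h => (natDegree_meixner_le_and_coeff a c ha0 ha1 n).2 (by rw [h, coeff_zero])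

lemma inv_one_sub_inv {a : ℝ} (ha0 : a ≠ 0) (ha1 : a ≠ 1) :
    (1 - 1 / a)⁻¹ = -(a / (1 - a)) := by
  have : 1 - a ≠ 0 := sub_ne_zero.mpr ha1.symm
  have : a - 1 ≠ 0 := sub_ne_zero.mpr ha1
  field_simp
  ring

lemma inv_div_one_sub_inv {a : ℝ} (ha0 : a ≠ 0) (ha1 : a ≠ 1) :
    1 / a / (1 - 1 / a) = -(1 - a)⁻¹ := by
  have : 1 - a ≠ 0 := sub_ne_zero.mpr ha1.symm
  have : a - 1 ≠ 0 := sub_ne_zero.mpr ha1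
  field_simp
  ring

/-! ### Twisted shifts -/

/-- The twisted shift `p(x) ↦ ρ p(x + 1)`: the action of the translation `x ↦ x + 1` on the
polynomial factor of the formal function `ρ ^ x p(x)`. -/
noncomputable def twShift (ρ : ℝ) : Module.End ℝ ℝ[X] := ρ • taylor 1

lemma twShift_apply (ρ : ℝ) (p : ℝ[X]) : twShift ρ p = C ρ * p.comp (X + 1) := by
  simp [twShift, smul_eq_C_mul, taylor_apply]

lemma twShift_mul (ρ : ℝ) (p q : ℝ[X]) : twShift ρ (p * q) = taylor 1 p * twShift ρ q := by
  simp [twShift, taylor_mul]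

lemma twShift_pow_apply (ρ : ℝ) (l : ℕ) (p : ℝ[X]) :
    (twShift ρ ^ l) p = C (ρ ^ l) * shift l p := by
  induction l with
  | zero => simp [shift]
  | succ l ih =>
    rw [pow_succ', Module.End.mul_apply, ih, twShift_apply, shift, shift, mul_comp, C_comp,
      comp_assoc, pow_succ', C_mul]
    have : (X + C (l : ℝ) : ℝ[X]).comp (X + 1) = X + C ((l + 1 : ℕ) : ℝ) := by
      simp [add_assoc, add_comm]
    rw [this]; ring

lemma coeff_taylor_one (p : ℝ[X]) (N n : ℕ) (hp : p.natDegree < N) :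
    (taylor 1 p).coeff n = ∑ i ∈ Finset.range N, (i.choose n : ℝ) * p.coeff i := by
  rw [taylor_coeff, hasseDeriv_apply, eval_sum,
    sum_over_range' _ (by intro n; simp) N hp]
  simp

/-- The difference `p(x + 1) - p(x)` has smaller degree, and its top coefficient is that of the
derivative. -/
lemma natDegree_twShift_sub_le (ρ : ℝ) (p : ℝ[X]) (d : ℕ) (hp : p.natDegree ≤ d + 1) :
    (twShift ρ p - ρ • p).natDegree ≤ d ∧
      (twShift ρ p - ρ • p).coeff d = ρ * (d + 1) * p.coeff (d + 1) := by
  have h := coeff_taylor_one p (d + 2)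
  constructor
  · rw [natDegree_le_iff_coeff_eq_zero]
    intro n hn
    rw [twShift, LinearMap.smul_apply, ← smul_sub, coeff_smul, coeff_sub, h n (by omega)]
    by_cases hn' : n = d + 1
    · subst hn'
      rw [Finset.sum_range_succ, Finset.sum_eq_zero]
      · simp
      · intro i hi
        rw [Nat.choose_eq_zero_of_lt (Finset.mem_range.mp hi)]; simp
    · rw [Finset.sum_eq_zero, coeff_eq_zero_of_natDegree_lt (by omega)]
      · simp
      · intro i hi
        rw [Nat.choose_eq_zero_of_lt (by have := Finset.mem_range.mp hi; omega)]; simp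
  · rw [twShift, LinearMap.smul_apply, ← smul_sub, coeff_smul, coeff_sub, h d (by omega),
      Finset.sum_range_succ, Finset.sum_range_succ, Finset.sum_eq_zero]
    · simp [Nat.choose_succ_self_right]
      ring
    · intro i hi
      rw [Nat.choose_eq_zero_of_lt (Finset.mem_range.mp hi)]; simp

lemma twShift_of_natDegree_zero (ρ : ℝ) (p : ℝ[X]) (hp : p.natDegree ≤ 0) :
    twShift ρ p - ρ • p = 0 := by
  rw [eq_C_of_natDegree_le_zero hp, twShift_apply, C_comp, smul_eq_C_mul, sub_self]

/-- Powers of `T - ρ`, where `T` is the shift twisted by `ρ`, lower the degree, as powers of the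
derivative do. The factor `X ^ i` keeps the statement free of truncated subtraction. -/
lemma natDegree_X_pow_mul_twShift_sub_pow (ρ : ℝ) (i : ℕ) : ∀ (p : ℝ[X]) (d : ℕ),
    p.natDegree ≤ d →
    (X ^ i * ((twShift ρ - ρ • 1) ^ i) p).natDegree ≤ d ∧
      (X ^ i * ((twShift ρ - ρ • 1) ^ i) p).coeff d =
        ρ ^ i * (d.descFactorial i : ℝ) * p.coeff d := by
  induction i with
  | zero => intro p d hp; simpa using hp
  | succ i ih =>
    intro p d hp
    have e : ((twShift ρ - ρ • 1) ^ (i + 1)) p =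
        ((twShift ρ - ρ • 1) ^ i) (twShift ρ p - ρ • p) := by
      rw [pow_succ, Module.End.mul_apply]; rfl
    rcases d with _ | d
    · rw [e, twShift_of_natDegree_zero ρ p hp]; simp
    · obtain ⟨h1, h2⟩ := natDegree_twShift_sub_le ρ p d hp
      obtain ⟨h3, h4⟩ := ih _ d h1
      rw [e, pow_succ', mul_assoc]
      constructor
      · refine natDegree_mul_le.trans ?_
        rw [natDegree_X]; omega
      · rw [coeff_X_mul, h4, h2, Nat.succ_descFactorial_succ]
        push_cast; ring

lemma natDegree_twShift_sub_pow (ρ σ : ℝ) (i : ℕ) (p : ℝ[X]) (d : ℕ) (hp : p.natDegree ≤ d) :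
    (((twShift ρ - σ • 1) ^ i) p).natDegree ≤ d ∧
      (((twShift ρ - σ • 1) ^ i) p).coeff d = (ρ - σ) ^ i * p.coeff d := by
  induction i with
  | zero => simpa using hp
  | succ i ih =>
    obtain ⟨h1, h2⟩ := ih
    set q := ((twShift ρ - σ • 1) ^ i) p
    have e : ((twShift ρ - σ • 1) ^ (i + 1)) p = (twShift ρ q - ρ • q) + (ρ - σ) • q := by
      rw [pow_succ', Module.End.mul_apply]
      simp [q, sub_smul]
    have h : (twShift ρ q - ρ • q).natDegree ≤ d ∧ (twShift ρ q - ρ • q).coeff d = 0 := by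
      rcases d with _ | d
      · rw [twShift_of_natDegree_zero ρ q h1]; simp
      · have := (natDegree_twShift_sub_le ρ q d h1).1
        exact ⟨by omega, coeff_eq_zero_of_natDegree_lt (by omega)⟩
    rw [e]
    constructor
    · exact natDegree_add_le_of_degree_le h.1 ((natDegree_smul_le _ _).trans h1)
    · rw [coeff_add, h.2, coeff_smul, h2, smul_eq_mul, pow_succ]; ring

/-! ### The degree of a Casoratian -/

lemma coeff_prod_of_natDegree_le_sum {ι : Type*} (s : Finset ι) (f : ι → ℝ[X]) (r : ι → ℕ)
    (h : ∀ i ∈ s, (f i).natDegree ≤ r i) :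
    (∏ i ∈ s, f i).natDegree ≤ ∑ i ∈ s, r i ∧
      (∏ i ∈ s, f i).coeff (∑ i ∈ s, r i) = ∏ i ∈ s, (f i).coeff (r i) := by
  classical
  induction s using Finset.induction_on with
  | empty => simp
  | insert i s hi ih =>
    obtain ⟨h1, h2⟩ := ih fun j hj => h j (Finset.mem_insert_of_mem hj)
    have h3 := h i (Finset.mem_insert_self i s)
    rw [Finset.prod_insert hi, Finset.sum_insert hi, Finset.prod_insert hi, ← h2]
    exact ⟨natDegree_mul_le_of_le h3 h1, coeff_mul_add_eq_of_natDegree_le h3 h1⟩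

/-- If the entries of each row have bounded degree, then so has the determinant, and its top
coefficient is the determinant of the top coefficients. -/
lemma coeff_det_of_natDegree_le {ι : Type*} [Fintype ι] [DecidableEq ι] (M : Matrix ι ι ℝ[X])
    (r : ι → ℕ) (h : ∀ i j, (M i j).natDegree ≤ r i) :
    M.det.natDegree ≤ ∑ i, r i ∧
      M.det.coeff (∑ i, r i) = (Matrix.of fun i j => (M i j).coeff (r i)).det := by
  have key : ∀ σ : Equiv.Perm ι, (∏ i, M (σ i) i).natDegree ≤ ∑ i, r i ∧
      (∏ i, M (σ i) i).coeff (∑ i, r i) = ∏ i, (M (σ i) i).coeff (r (σ i)) := by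
    intro σ
    have := coeff_prod_of_natDegree_le_sum Finset.univ (fun i => M (σ i) i) (fun i => r (σ i))
      fun i _ => h _ _
    rwa [Equiv.sum_comp σ r] at this
  constructor
  · rw [Matrix.det_apply]
    refine natDegree_sum_le_of_forall_le _ _ fun σ _ => ?_
    rcases Int.units_eq_one_or (Equiv.Perm.sign σ) with hs | hs <;> rw [hs] <;>
      simpa using (key σ).1
  · rw [Matrix.det_apply, Matrix.det_apply, finsetSum_coeff]
    refine Finset.sum_congr rfl fun σ _ => ?_
    rcases Int.units_eq_one_or (Equiv.Perm.sign σ) with hs | hs <;> rw [hs] <;>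
      simp [(key σ).2]

/-- The matrix of falling factorials of distinct numbers is nonsingular. -/
lemma det_descFactorial_ne_zero {k : ℕ} (d : Fin k → ℕ) (hd : Function.Injective d) :
    (Matrix.of fun i j : Fin k => ((d i).descFactorial j : ℝ)).det ≠ 0 := by
  have h := Matrix.det_eval_matrixOfPolynomials_eq_det_vandermonde (fun i => (d i : ℝ))
    (fun j : Fin k => descPochhammer ℝ j) (fun j => descPochhammer_natDegree ℝ j)
    (fun j => monic_descPochhammer ℝ j)
  simp only [descPochhammer_eval_eq_descFactorial] at h
  rw [← h, Matrix.det_vandermonde_ne_zero_iff]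
  exact Nat.cast_injective.comp hd

lemma det_weighted_ne_zero {k : ℕ} (v w : Fin k → ℝ) (A : Matrix (Fin k) (Fin k) ℝ)
    (hv : ∀ i, v i ≠ 0) (hw : ∀ i, w i ≠ 0) (hA : A.det ≠ 0) :
    (Matrix.of fun i j => w j * (v i * A i j)).det ≠ 0 := by
  have h := Matrix.det_mul_row w (Matrix.of fun i j => v i * A i j)
  simp only [Matrix.of_apply] at h
  rw [h, Matrix.det_mul_column]
  exact mul_ne_zero (Finset.prod_ne_zero_iff.mpr fun i _ => hw i)
    (mul_ne_zero (Finset.prod_ne_zero_iff.mpr fun i _ => hv i) hA)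

/-- Polynomials in the shift `T` adapted to `k₁` rows with twist `1` and `k₂` rows with twist `b`:
`(T - 1)^i (T - b)^k₂` for `i < k₁`, and `(T - 1)^k₁ (T - b)^j` for `j < k₂`. -/
noncomputable def adaptedPoly (b : ℝ) (k₁ k₂ : ℕ) : Fin k₁ ⊕ Fin k₂ → ℝ[X] :=
  Sum.elim (fun i => (X - C 1) ^ (i : ℕ) * (X - C b) ^ k₂)
    (fun j => (X - C 1) ^ k₁ * (X - C b) ^ (j : ℕ))

lemma natDegree_adaptedPoly_lt (b : ℝ) (k₁ k₂ : ℕ) (t : Fin k₁ ⊕ Fin k₂) :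
    (adaptedPoly b k₁ k₂ t).natDegree < k₁ + k₂ := by
  have h : ∀ m n : ℕ, ((X - C 1 : ℝ[X]) ^ m * (X - C b) ^ n).natDegree ≤ m + n := by
    intro m n
    refine natDegree_mul_le.trans ?_
    rw [natDegree_pow, natDegree_pow, natDegree_X_sub_C, natDegree_X_sub_C]; omega
  rcases t with i | j
  · exact lt_of_le_of_lt (h _ _) (by have := i.2; omega)
  · exact lt_of_le_of_lt (h _ _) (by have := j.2; omega)

lemma aeval_twShift_mul_pow (ρ σ τ : ℝ) (m n : ℕ) (p : ℝ[X]) :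
    aeval (twShift ρ) ((X - C σ) ^ m * (X - C τ) ^ n) p =
      ((twShift ρ - σ • 1) ^ m) (((twShift ρ - τ • 1) ^ n) p) := by
  rw [map_mul, map_pow, map_pow, map_sub, map_sub, aeval_X, aeval_C, aeval_C,
    Algebra.algebraMap_eq_smul_one, Algebra.algebraMap_eq_smul_one, Module.End.mul_apply]

/-- Rows and columns carry weights for which every entry is bounded by the weight of its row and the
two off-diagonal blocks are strictly subdominant, so the top coefficient of the determinant is a
product of two determinants of falling factorials. -/
lemma det_adaptedPoly (b : ℝ) (hb0 : b ≠ 0) (hb1 : b ≠ 1) (k₁ k₂ : ℕ)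
    (ρ : Fin k₁ ⊕ Fin k₂ → ℝ) (φ : Fin k₁ ⊕ Fin k₂ → ℝ[X])
    (hρ₁ : ∀ i, ρ (Sum.inl i) = 1) (hρ₂ : ∀ j, ρ (Sum.inr j) = b) (hφ : ∀ s, φ s ≠ 0)
    (hinj : ∀ s t, ρ s = ρ t → (φ s).natDegree = (φ t).natDegree → s = t) :
    let D := (Matrix.of fun s t => aeval (twShift (ρ s)) (adaptedPoly b k₁ k₂ t) (φ s)).det
    D ≠ 0 ∧ D.natDegree + k₁.choose 2 + k₂.choose 2 = ∑ s, (φ s).natDegree := by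
  intro D
  set N : Matrix (Fin k₁ ⊕ Fin k₂) (Fin k₁ ⊕ Fin k₂) ℝ[X] :=
    Matrix.of fun s t => aeval (twShift (ρ s)) (adaptedPoly b k₁ k₂ t) (φ s) with hN
  set e : Fin k₁ ⊕ Fin k₂ → ℕ := Sum.elim (fun i => i + k₂) (fun j => j + k₁) with he
  set r : Fin k₁ ⊕ Fin k₂ → ℕ := Sum.elim (fun i => (φ (Sum.inl i)).natDegree + k₂)
    (fun j => (φ (Sum.inr j)).natDegree + k₁) with hr
  set P : Matrix (Fin k₁) (Fin k₁) ℝ := Matrix.of fun i i' =>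
    ((φ (Sum.inl i)).leadingCoeff * (1 - b) ^ k₂) *
      ((φ (Sum.inl i)).natDegree.descFactorial i' : ℝ) with hP
  set Q : Matrix (Fin k₂) (Fin k₂) ℝ := Matrix.of fun j j' =>
    b ^ (j' : ℕ) * (((φ (Sum.inr j)).leadingCoeff * (b - 1) ^ k₁) *
      ((φ (Sum.inr j)).natDegree.descFactorial j' : ℝ)) with hQ
  have hPdet : P.det ≠ 0 := by
    have := det_weighted_ne_zero (fun i => (φ (Sum.inl i)).leadingCoeff * (1 - b) ^ k₂) 1 _
      (fun i => mul_ne_zero (leadingCoeff_ne_zero.mpr (hφ _))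
        (pow_ne_zero _ (sub_ne_zero.mpr hb1.symm))) (fun _ => one_ne_zero)
      (det_descFactorial_ne_zero (fun i => (φ (Sum.inl i)).natDegree) fun i i' h => ?_)
    · simpa using this
    exact Sum.inl_injective (hinj _ _ (by rw [hρ₁, hρ₁]) h)
  have hQdet : Q.det ≠ 0 := by
    refine det_weighted_ne_zero (fun j => (φ (Sum.inr j)).leadingCoeff * (b - 1) ^ k₁)
      (fun j' => b ^ (j' : ℕ)) _ (fun i => mul_ne_zero (leadingCoeff_ne_zero.mpr (hφ _))
        (pow_ne_zero _ (sub_ne_zero.mpr hb1))) (fun _ => pow_ne_zero _ hb0)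
      (det_descFactorial_ne_zero (fun j => (φ (Sum.inr j)).natDegree) fun i i' h => ?_)
    exact Sum.inr_injective (hinj _ _ (by rw [hρ₂, hρ₂]) h)
  have hent : ∀ s t, (X ^ e t * N s t).natDegree ≤ r s ∧
      (X ^ e t * N s t).coeff (r s) = Matrix.fromBlocks P 0 0 Q s t := by
    have aux : ∀ (m n k : ℕ) (p : ℝ[X]) (d : ℕ), (X ^ m * p).natDegree ≤ d →
        n = k + m → (X ^ n * p).natDegree ≤ d + k ∧
        (X ^ n * p).coeff (d + k) = (X ^ m * p).coeff d := by
      rintro m n k p d h rfl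
      rw [pow_add, mul_assoc]
      refine ⟨natDegree_mul_le.trans ?_, coeff_X_pow_mul _ _ _⟩
      rw [natDegree_X_pow]; omega
    rintro (i | j) (i' | j')
    · obtain ⟨h1, h2⟩ := natDegree_twShift_sub_pow 1 b k₂ (φ (Sum.inl i)) _ le_rfl
      obtain ⟨h3, h4⟩ := natDegree_X_pow_mul_twShift_sub_pow 1 i' _ _ h1
      obtain ⟨h5, h6⟩ := aux _ (i' + k₂) k₂ _ _ h3 (by omega)
      simp only [hN, Matrix.of_apply, hρ₁, adaptedPoly, Sum.elim_inl, aeval_twShift_mul_pow, he,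
        hr]
      refine ⟨h5, ?_⟩
      rw [h6, h4, h2, Matrix.fromBlocks_apply₁₁, hP, Matrix.of_apply, leadingCoeff]
      ring
    · obtain ⟨h1, h2⟩ := natDegree_twShift_sub_pow 1 b j' (φ (Sum.inl i)) _ le_rfl
      obtain ⟨h3, h4⟩ := natDegree_X_pow_mul_twShift_sub_pow 1 k₁ _ _ h1
      obtain ⟨h5, h6⟩ := aux _ (j' + k₁) j' _ _ h3 (by omega)
      simp only [hN, Matrix.of_apply, hρ₁, adaptedPoly, Sum.elim_inl, Sum.elim_inr,
        aeval_twShift_mul_pow, he, hr]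
      have := j'.2
      refine ⟨h5.trans (by omega), ?_⟩
      rw [coeff_eq_zero_of_natDegree_lt (lt_of_le_of_lt h5 (by omega))]
      rfl
    · obtain ⟨h1, h2⟩ := natDegree_twShift_sub_pow b 1 i' (φ (Sum.inr j)) _ le_rfl
      obtain ⟨h3, h4⟩ := natDegree_X_pow_mul_twShift_sub_pow b k₂ _ _ h1
      obtain ⟨h5, h6⟩ := aux _ (i' + k₂) i' _ _ h3 (by omega)
      simp only [hN, Matrix.of_apply, hρ₂, adaptedPoly, Sum.elim_inl, Sum.elim_inr, he, hr,
        mul_comm ((X - C 1 : ℝ[X]) ^ (i' : ℕ)) _, aeval_twShift_mul_pow]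
      have := i'.2
      refine ⟨h5.trans (by omega), ?_⟩
      rw [coeff_eq_zero_of_natDegree_lt (lt_of_le_of_lt h5 (by omega))]
      rfl
    · obtain ⟨h1, h2⟩ := natDegree_twShift_sub_pow b 1 k₁ (φ (Sum.inr j)) _ le_rfl
      obtain ⟨h3, h4⟩ := natDegree_X_pow_mul_twShift_sub_pow b j' _ _ h1
      obtain ⟨h5, h6⟩ := aux _ (j' + k₁) k₁ _ _ h3 (by omega)
      simp only [hN, Matrix.of_apply, hρ₂, adaptedPoly, Sum.elim_inr, he, hr,
        mul_comm ((X - C 1 : ℝ[X]) ^ k₁) _, aeval_twShift_mul_pow]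
      refine ⟨h5, ?_⟩
      rw [h6, h4, h2, Matrix.fromBlocks_apply₂₂, hQ, Matrix.of_apply, leadingCoeff]
      ring
  obtain ⟨h1, h2⟩ := coeff_det_of_natDegree_le (Matrix.of fun s t => X ^ e t * N s t) r
    (fun s t => by simpa only [Matrix.of_apply] using (hent s t).1)
  have h3 : (Matrix.of fun s t => ((Matrix.of fun s t => X ^ e t * N s t) s t).coeff (r s)) =
      Matrix.fromBlocks P 0 0 Q := by
    ext s t; exact (hent s t).2
  rw [h3, Matrix.det_fromBlocks_zero₂₁, Matrix.det_mul_row (fun t => X ^ e t) N] at h2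
  rw [Matrix.det_mul_row (fun t => X ^ e t) N] at h1
  have h4 := mul_ne_zero hPdet hQdet
  rw [← h2] at h4
  have hD : D ≠ 0 := by
    intro h0
    apply h4
    rw [show N.det = D from rfl, h0, mul_zero, coeff_zero]
  refine ⟨hD, ?_⟩
  have h5 := natDegree_eq_of_le_of_coeff_ne_zero h1 h4
  rw [Finset.prod_pow_eq_pow_sum, natDegree_mul (pow_ne_zero _ X_ne_zero) hD,
    natDegree_X_pow] at h5
  simp only [he, hr, Fintype.sum_sum_type, Sum.elim_inl, Sum.elim_inr, Finset.sum_add_distrib,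
    Finset.sum_const, Finset.card_univ, Fintype.card_fin, smul_eq_mul] at h5 ⊢
  have g1 : ∑ i : Fin k₁, (i : ℕ) = k₁.choose 2 := by
    rw [Fin.sum_univ_eq_sum_range (fun i => i), Finset.sum_range_id, Nat.choose_two_right]
  have g2 : ∑ i : Fin k₂, (i : ℕ) = k₂.choose 2 := by
    rw [Fin.sum_univ_eq_sum_range (fun i => i), Finset.sum_range_id, Nat.choose_two_right]
  rw [g1, g2] at h5
  have := mul_comm k₁ k₂
  omega

/-- A Casoratian of polynomials `φ s` twisted by `ρ s ∈ {1, b}`, with distinct degrees among the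
polynomials of equal twist, is nonzero of the expected degree. -/
theorem casoratian_ne_zero_and_natDegree {ι : Type*} [Fintype ι] [DecidableEq ι] (b : ℝ)
    (hb0 : b ≠ 0) (hb1 : b ≠ 1) {k₁ k₂ k : ℕ} (σ : ι ≃ Fin k) (ρ : ι → ℝ) (φ : ι → ℝ[X])
    (hρ : ∀ s, ρ s = 1 ∨ ρ s = b) (hφ : ∀ s, φ s ≠ 0)
    (hinj : ∀ s t, ρ s = ρ t → (φ s).natDegree = (φ t).natDegree → s = t)
    (hk₁ : ∑ s, (if ρ s = 1 then 1 else 0) = k₁) (hk : k = k₁ + k₂) :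
    let D := (Matrix.of fun s t => (twShift (ρ s) ^ (σ t : ℕ)) (φ s)).det
    D ≠ 0 ∧ D.natDegree + k₁.choose 2 + k₂.choose 2 = ∑ s, (φ s).natDegree := by
  intro D
  have c1 : Fintype.card {s // ρ s = 1} = k₁ := by
    rw [Fintype.card_subtype, ← hk₁, Finset.card_filter]
  have c2 : Fintype.card {s // ¬ ρ s = 1} = k₂ := by
    rw [Fintype.card_subtype_compl, c1, Fintype.card_congr σ, Fintype.card_fin]; omega
  set e : Fin k₁ ⊕ Fin k₂ ≃ ι := (Equiv.sumCongr (Fintype.equivFinOfCardEq c1)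
    (Fintype.equivFinOfCardEq c2)).symm.trans (Equiv.sumCompl (fun s => ρ s = 1)) with he
  have e1 : ∀ i, ρ (e (Sum.inl i)) = 1 := fun i => by
    simpa [he] using ((Fintype.equivFinOfCardEq c1).symm i).2
  have e2 : ∀ i, ρ (e (Sum.inr i)) = b := fun i => by
    refine (hρ _).resolve_left ?_
    simpa [he] using ((Fintype.equivFinOfCardEq c2).symm i).2
  obtain ⟨h1, h2⟩ := det_adaptedPoly b hb0 hb1 k₁ k₂ (ρ ∘ e) (φ ∘ e) e1 e2 (fun s => hφ _)
    (fun s t h h' => e.injective (hinj _ _ h h'))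
  set M : Matrix ι ι ℝ[X] := Matrix.of fun s t => (twShift (ρ s) ^ (σ t : ℕ)) (φ s) with hM
  set K : Matrix (Fin k₁ ⊕ Fin k₂) (Fin k₁ ⊕ Fin k₂) ℝ :=
    Matrix.of fun s t => (adaptedPoly b k₁ k₂ t).coeff (σ (e s)) with hK
  have hprod : (Matrix.of fun s t => aeval (twShift ((ρ ∘ e) s)) (adaptedPoly b k₁ k₂ t)
      ((φ ∘ e) s)) = M.submatrix e e * K.map C := by
    ext1 s t
    rw [Matrix.of_apply, Matrix.mul_apply, aeval_eq_sum_range'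
      (lt_of_lt_of_eq (natDegree_adaptedPoly_lt b k₁ k₂ t) hk.symm), LinearMap.sum_apply,
      ← Fin.sum_univ_eq_sum_range (fun l => ((adaptedPoly b k₁ k₂ t).coeff l •
        twShift ((ρ ∘ e) s) ^ l) ((φ ∘ e) s)), ← Equiv.sum_comp (e.trans σ)]
    refine Finset.sum_congr rfl fun u _ => ?_
    simp [hM, hK, smul_eq_C_mul, mul_comm]
  have hdet : (K.map C).det = C K.det := by
    rw [← RingHom.mapMatrix_apply, ← RingHom.map_det]
  rw [hprod, Matrix.det_mul, Matrix.det_submatrix_equiv_self, hdet] at h1 h2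
  have hD : D ≠ 0 := left_ne_zero_of_mul h1
  refine ⟨hD, ?_⟩
  rw [natDegree_mul_C (by intro h; rw [h] at h1; simp at h1)] at h2
  rw [h2, ← Equiv.sum_comp e]
  rfl

/-! ### The rows of the Casoratian and their degrees -/

/-- The twists of the rows: `1` for the rows of `F₁` and `1 / a` for those of `F₂`. -/
noncomputable def rowTwist (a : ℝ) (F₁ F₂ : Finset ℕ) : Fin (F₁.card + F₂.card) → ℝ :=
  Fin.append (fun _ => 1) (fun _ => a⁻¹)

/-- The polynomials in the first column of the Casoratian. -/
noncomputable def rowPoly (a c : ℝ) (F₁ F₂ : Finset ℕ) : Fin (F₁.card + F₂.card) → ℝ[X] :=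
  Fin.append (fun i => meixner a c (elt F₁ i)) (fun i => meixner (1 / a) c (elt F₂ i))

lemma rows_eq (a c : ℝ) (F₁ F₂ : Finset ℕ) (i : Fin (F₁.card + F₂.card)) (l : ℕ) :
    rows a c F₁ F₂ i l = (twShift (rowTwist a F₁ F₂ i) ^ l) (rowPoly a c F₁ F₂ i) := by
  rw [twShift_pow_apply]
  refine Fin.addCases (fun i => ?_) (fun i => ?_) i
  · simp [rows, rowTwist, rowPoly]
  · simp [rows, rowTwist, rowPoly]

lemma elt_injective (F : Finset ℕ) : Function.Injective (elt F) :=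
  (F.orderEmbOfFin rfl).injective

lemma elt_mem (F : Finset ℕ) (i : Fin F.card) : elt F i ∈ F := Finset.orderEmbOfFin_mem F rfl i

lemma sum_elt {A : Type*} [AddCommMonoid A] (F : Finset ℕ) (g : ℕ → A) :
    ∑ i, g (elt F i) = ∑ f ∈ F, g f := by
  rw [← Finset.sum_coe_sort F g, ← Equiv.sum_comp (F.orderIsoOfFin rfl).toEquiv]
  rfl

lemma one_div_ne_zero_and_ne_one {a : ℝ} (ha0 : a ≠ 0) (ha1 : a ≠ 1) :
    1 / a ≠ 0 ∧ 1 / a ≠ 1 :=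
  ⟨one_div_ne_zero ha0, fun h => ha1 (by rw [div_eq_one_iff_eq ha0] at h; exact h.symm)⟩

lemma natDegree_rowPoly (a c : ℝ) (ha0 : a ≠ 0) (ha1 : a ≠ 1) (F₁ F₂ : Finset ℕ)
    (i : Fin (F₁.card + F₂.card)) :
    rowPoly a c F₁ F₂ i ≠ 0 ∧ (rowPoly a c F₁ F₂ i).natDegree = Fin.append (elt F₁) (elt F₂) i := by
  obtain ⟨hb0, hb1⟩ := one_div_ne_zero_and_ne_one ha0 ha1
  refine Fin.addCases (fun i => ?_) (fun i => ?_) i <;>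
    simp only [rowPoly, Fin.append_left, Fin.append_right]
  · exact ⟨meixner_ne_zero _ _ ha0 ha1 _, natDegree_meixner _ _ ha0 ha1 _⟩
  · exact ⟨meixner_ne_zero _ _ hb0 hb1 _, natDegree_meixner _ _ hb0 hb1 _⟩

lemma inv_ne_one_of_ne_one {a : ℝ} (ha1 : a ≠ 1) : a⁻¹ ≠ 1 := by simpa using ha1

lemma rowTwist_eq (a : ℝ) (F₁ F₂ : Finset ℕ) (i : Fin (F₁.card + F₂.card)) :
    rowTwist a F₁ F₂ i = 1 ∨ rowTwist a F₁ F₂ i = a⁻¹ := by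
  refine Fin.addCases (fun i => ?_) (fun i => ?_) i <;> simp [rowTwist]

lemma rowTwist_elt_injective {a : ℝ} (ha1 : a ≠ 1) (F₁ F₂ : Finset ℕ)
    (i j : Fin (F₁.card + F₂.card)) (h : rowTwist a F₁ F₂ i = rowTwist a F₁ F₂ j)
    (h' : Fin.append (elt F₁) (elt F₂) i = Fin.append (elt F₁) (elt F₂) j) : i = j := by
  have hb1 := inv_ne_one_of_ne_one ha1
  revert h h'
  refine Fin.addCases (fun i => ?_) (fun i => ?_) i <;>
    refine Fin.addCases (fun j => ?_) (fun j => ?_) j <;>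
    simp only [rowTwist, Fin.append_left, Fin.append_right] <;> intro h h'
  · rw [elt_injective _ h']
  · exact absurd h.symm hb1
  · exact absurd h hb1
  · rw [elt_injective _ h']

lemma sum_rowTwist {a : ℝ} (ha1 : a ≠ 1) (F₁ F₂ : Finset ℕ) :
    ∑ i, (if rowTwist a F₁ F₂ i = 1 then 1 else 0) = F₁.card := by
  have hb1 := inv_ne_one_of_ne_one ha1
  simp [Fin.sum_univ_add, rowTwist, ha1]

lemma casoratian_eq (a c : ℝ) (F₁ F₂ : Finset ℕ) :
    casoratian a c F₁ F₂ = (Matrix.of fun i l : Fin (F₁.card + F₂.card) =>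
      (twShift (rowTwist a F₁ F₂ i) ^ (l : ℕ)) (rowPoly a c F₁ F₂ i)).det := by
  simp only [casoratian, rows_eq]

theorem natDegree_casoratian (a c : ℝ) (ha0 : a ≠ 0) (ha1 : a ≠ 1) (F₁ F₂ : Finset ℕ) :
    casoratian a c F₁ F₂ ≠ 0 ∧ (casoratian a c F₁ F₂).natDegree + F₁.card.choose 2 +
      F₂.card.choose 2 = ∑ f ∈ F₁, f + ∑ f ∈ F₂, f := by
  obtain ⟨h1, h2⟩ := casoratian_ne_zero_and_natDegree a⁻¹ (inv_ne_zero ha0)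
    (inv_ne_one_of_ne_one ha1) (k₁ := F₁.card) (k₂ := F₂.card)
    (Equiv.refl (Fin (F₁.card + F₂.card))) (rowTwist a F₁ F₂) (rowPoly a c F₁ F₂)
    (rowTwist_eq a F₁ F₂) (fun i => (natDegree_rowPoly a c ha0 ha1 F₁ F₂ i).1)
    (fun i j h h' => rowTwist_elt_injective ha1 F₁ F₂ i j h
      (by rwa [(natDegree_rowPoly a c ha0 ha1 F₁ F₂ i).2,
        (natDegree_rowPoly a c ha0 ha1 F₁ F₂ j).2] at h')) (sum_rowTwist ha1 F₁ F₂) rfl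
  rw [casoratian_eq]
  refine ⟨h1, h2.trans ?_⟩
  simp only [(natDegree_rowPoly a c ha0 ha1 F₁ F₂ _).2]
  rw [Fin.sum_univ_add]
  simp only [Fin.append_left, Fin.append_right]
  rw [sum_elt F₁ (fun f => f), sum_elt F₂ (fun f => f)]

/-! ### Invariance of the Casoratian under the involution -/

/-- The number `max F + 1`, equal to `0` for the empty set. -/
def topCount (F : Finset ℕ) : ℕ := if F.Nonempty then F.sup id + 1 else 0

lemma maxInt_eq (F : Finset ℕ) : maxInt F = (topCount F : ℤ) - 1 := by
  rw [maxInt, topCount]; split_ifs <;> simp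

lemma lt_topCount {F : Finset ℕ} {f : ℕ} (hf : f ∈ F) : f < topCount F := by
  rw [topCount, if_pos ⟨f, hf⟩]
  exact Nat.lt_succ_of_le (Finset.le_sup (f := id) hf)

lemma mem_invol {F : Finset ℕ} {g : ℕ} :
    g ∈ invol F ↔ g < topCount F ∧ topCount F - 1 - g ∉ F := by
  rw [invol, topCount]
  rcases F.eq_empty_or_nonempty with rfl | hF
  · simp
  · rw [if_pos hF, Finset.mem_sdiff, Finset.mem_Icc, Finset.mem_image, Nat.add_sub_cancel]
    obtain ⟨m, hm, hm'⟩ := Finset.exists_mem_eq_sup F hF id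
    have hle : ∀ x ∈ F, x ≤ F.sup id := fun x hx => Finset.le_sup (f := id) hx
    rw [id_eq] at hm'
    constructor
    · rintro ⟨⟨h1, h2⟩, h3⟩
      refine ⟨by omega, fun h => h3 ⟨_, h, by omega⟩⟩
    · rintro ⟨h1, h2⟩
      refine ⟨⟨?_, by omega⟩, ?_⟩
      · rcases g with _ | g
        · rw [Nat.sub_zero, hm'] at h2; exact absurd hm h2
        · omega
      · rintro ⟨x, hx, hx'⟩
        have := hle x hx
        apply h2
        rwa [show F.sup id - g = x by omega]

/-- `F` and the reflection of `I(F)` partition `{0, 1, …, max F}`. -/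
lemma sum_add_sum_invol {A : Type*} [AddCommMonoid A] (F : Finset ℕ) (g : ℕ → A) :
    ∑ i, g (elt F i) + ∑ i, g (topCount F - 1 - elt (invol F) i) =
      ∑ f ∈ Finset.range (topCount F), g f := by
  have hsub : F ⊆ Finset.range (topCount F) := fun f hf => Finset.mem_range.mpr (lt_topCount hf)
  rw [sum_elt, sum_elt (invol F) (fun f => g (topCount F - 1 - f)),
    ← Finset.sum_sdiff hsub, add_comm]
  congr 1
  refine Finset.sum_bij (fun f _ => topCount F - 1 - f) ?_ ?_ ?_ ?_
  · intro f hf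
    obtain ⟨h1, h2⟩ := mem_invol.mp hf
    exact Finset.mem_sdiff.mpr ⟨Finset.mem_range.mpr (by omega), h2⟩
  · intro f hf f' hf' h
    have := (mem_invol.mp hf).1
    have := (mem_invol.mp hf').1
    omega
  · intro f hf
    obtain ⟨h1, h2⟩ := Finset.mem_sdiff.mp hf
    rw [Finset.mem_range] at h1
    refine ⟨topCount F - 1 - f, mem_invol.mpr ⟨by omega, ?_⟩, by omega⟩
    rwa [show topCount F - 1 - (topCount F - 1 - f) = f by omega]
  · intros; rfl

lemma card_add_card_invol (F : Finset ℕ) : F.card + (invol F).card = topCount F := by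
  have := sum_add_sum_invol F (fun _ => 1)
  simpa using this

lemma binomSeries_zero (γ : ℝ) : binomSeries γ 0 = 1 := by
  ext1 n
  rcases n with _ | n
  · simp [binomSeries, binomPoly_zero]
  · have : (binomPoly (n + 1)).comp 0 = 0 := by
      rw [binomPoly, mul_comp, comp_zero, comp_zero,
        descPochhammer_ne_zero_eval_zero ℝ (Nat.succ_ne_zero n)]
      simp
    rw [binomSeries, PowerSeries.coeff_mk, this, mul_zero, PowerSeries.coeff_one,
      if_neg (Nat.succ_ne_zero n)]

lemma eval_zero_meixner_zero (a : ℝ) (ha0 : a ≠ 0) (n : ℤ) :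
    (meixner a 0 n).eval 0 = if n = 0 then 1 else 0 := by
  have h := meixner_comp a 0 ha0 n 0
  rw [genSeries, map_zero, neg_zero, sub_zero, binomSeries_zero, binomSeries_zero, one_mul] at h
  have h' := congrArg (eval 0) h
  rw [eval_comp, eval_zero] at h'
  rw [h', intCoeff]
  rcases n with n | n
  · rw [if_neg (by simp)]
    rcases n with _ | n
    · simp
    · simp [PowerSeries.coeff_one]
      omega
  · simp [Int.negSucc_lt_zero]

/-- Reflection of the coefficients of the polynomial `(1 + α z)^m (1 + β z)^m'`, whose coefficients
are the values at `m` of Meixner polynomials with second parameter `-(m + m')`. -/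
lemma eval_meixner_reflect (a : ℝ) (ha0 : a ≠ 0) (ha1 : a ≠ 1) (m m' : ℕ) : ∀ (n n' : ℤ),
    n + n' = m + m' → (meixner a (-(m + m')) n).eval (m : ℝ) =
      (1 - a)⁻¹ ^ m * (a / (1 - a)) ^ m' * (-((1 - a)⁻¹ * (a / (1 - a)))) ^ (-n') *
        (meixner (1 / a) (-(m + m')) n').eval (m : ℝ) := by
  have hb0 := (one_div_ne_zero_and_ne_one ha0 ha1).1
  have hs : 1 - a ≠ 0 := sub_ne_zero.mpr ha1.symm
  have hα : (1 - a)⁻¹ ≠ 0 := inv_ne_zero hs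
  have hβ : a / (1 - a) ≠ 0 := div_ne_zero ha0 hs
  have e1 := inv_one_sub_inv ha0 ha1
  have e2 := inv_div_one_sub_inv ha0 ha1
  set α := (1 - a)⁻¹
  set β := a / (1 - a)
  have hαβ : -(α * β) ≠ 0 := neg_ne_zero.mpr (mul_ne_zero hα hβ)
  have hz : ∀ n' : ℤ, (-(α * β)) ^ (-(n' - 1)) = -(α * β) * (-(α * β)) ^ (-n') := by
    intro n'
    rw [show -(n' - 1) = 1 + -n' by ring, zpow_one_add₀ hαβ]
  induction m with
  | zero =>
    induction m' with
    | zero =>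
      intro n n' h
      simp only [Nat.cast_zero, add_zero, neg_zero, eval_zero_meixner_zero a ha0,
        eval_zero_meixner_zero (1 / a) hb0, pow_zero, one_mul]
      simp only [Nat.cast_zero, add_zero] at h
      by_cases hn : n = 0
      · have : n' = 0 := by omega
        simp [hn, this]
      · have : n' ≠ 0 := by omega
        simp [hn, this]
    | succ m' ih =>
      intro n n' h
      push_cast at h ⊢
      have s1 := congrArg (eval 0) (meixner_sub_one a (-(0 + m')) ha0 n)
      have s2 := congrArg (eval 0) (meixner_sub_one (1 / a) (-(0 + m')) hb0 n')
      rw [e2] at s2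
      simp only [eval_add, eval_mul, eval_C] at s1 s2
      have i1 := ih n (n' - 1) (by push_cast; linarith)
      have i2 := ih (n - 1) n' (by push_cast; linarith)
      simp only [Nat.cast_zero] at i1 i2
      rw [show (-(0 + ((m' : ℝ) + 1))) = -(0 + (m' : ℝ)) - 1 by ring, s1, s2, i1, i2, hz]
      ring
  | succ m ih =>
    intro n n' h
    push_cast at h ⊢
    have s1 := congrArg (eval (m : ℝ)) (meixner_sub_one_shift a (-(m + m')) ha0 n)
    have s2 := congrArg (eval (m : ℝ)) (meixner_sub_one_shift (1 / a) (-(m + m')) hb0 n')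
    rw [e1] at s2
    simp only [eval_add, eval_mul, eval_C, eval_comp, eval_X, eval_one] at s1 s2
    have i1 := ih n (n' - 1) (by linarith)
    have i2 := ih (n - 1) n' (by linarith)
    rw [show (-((m : ℝ) + 1 + m')) = -((m : ℝ) + (m' : ℝ)) - 1 by ring, s1, s2, i1, i2, hz]
    ring

/-- The addition formula in a form that includes the empty sum. -/
lemma sum_meixner_shift (a c c' : ℝ) (ha0 : a ≠ 0) (N i j : ℕ) :
    ∑ f ∈ Finset.range N, shift i (meixner a c f) *
        (shift j (meixner a c' (N - 1 - f : ℕ))).comp (-X) =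
      C ((meixner a (c + c') ((N : ℤ) - 1)).eval (((i + j : ℕ) : ℝ))) := by
  rcases N with _ | N
  · simp [meixner_of_neg]
  · have h := sum_meixner_mul_meixner a c c' ha0 N (X + C (i : ℝ)) (-X + C (j : ℝ))
    have e : (X + C (i : ℝ) + (-X + C (j : ℝ)) : ℝ[X]) = C ((i + j : ℕ) : ℝ) := by
      push_cast [map_add]; ring
    rw [e, comp_C] at h
    push_cast [add_sub_cancel_right] at h ⊢
    rw [← h]
    refine Finset.sum_congr rfl fun f _ => ?_
    simp only [shift, comp_assoc, add_comp, X_comp, C_comp]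

/-- If the rows of `A` are paired with `B` to give a matrix whose first block vanishes, then the
upper left minor of `A` is proportional to the lower minor of `B`. -/
lemma det_toBlocks_mul_det {R m n : Type*} [CommRing R] [Fintype m] [Fintype n] [DecidableEq m]
    [DecidableEq n] (A : Matrix (m ⊕ n) (m ⊕ n) R) (B : Matrix (m ⊕ n) n R) (H : Matrix n n R)
    (h : B.transpose * A = Matrix.fromCols 0 H) :
    A.toBlocks₁₁.det * H.det = (Matrix.of fun s t => B (Sum.inr s) t).det * A.det := by
  set B₁ : Matrix m n R := Matrix.of fun s t => B (Sum.inl s) t with hB₁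
  set B₂ : Matrix n n R := Matrix.of fun s t => B (Sum.inr s) t with hB₂
  have hB : B = Matrix.fromRows B₁ B₂ := by ext (s | s) t <;> rfl
  have key : Matrix.fromBlocks 1 0 B₁.transpose B₂.transpose * A =
      Matrix.fromBlocks A.toBlocks₁₁ A.toBlocks₁₂ 0 H := by
    rw [hB, Matrix.transpose_fromRows, ← Matrix.fromBlocks_toBlocks A,
      Matrix.fromCols_mul_fromBlocks] at h
    obtain ⟨h1, h2⟩ := Matrix.fromCols_inj h
    nth_rewrite 1 [← Matrix.fromBlocks_toBlocks A]
    rw [Matrix.fromBlocks_multiply, h1, h2]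
    simp
  have := congrArg Matrix.det key
  rw [Matrix.det_mul, Matrix.det_fromBlocks_zero₁₂, Matrix.det_fromBlocks_zero₂₁, Matrix.det_one,
    one_mul, Matrix.det_transpose] at this
  exact this.symm

/-- The bilinear pairing between the rows with parameter `c` at `x` and those with parameter `c'`
at `-x`, with the weight `κ` on the second family. It only depends on `i + j`. -/
noncomputable def pairing (a c κ : ℝ) (n₁ n₂ : ℤ) (m : ℕ) : ℝ :=
  (meixner a c n₁).eval (m : ℝ) + κ * (a⁻¹ ^ m * (meixner (1 / a) c n₂).eval (m : ℝ))

/-- With `N + 2` rows in all, the generating function behind the pairing is a polynomial of degree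
`N`, and the two families read the same coefficient of it from its two ends. -/
lemma exists_pairing_eq_zero (a : ℝ) (ha0 : a ≠ 0) (ha1 : a ≠ 1) (n₁ n₂ : ℤ) :
    ∃ κ : ℝ, κ ≠ 0 ∧ ∀ m : ℕ, (m : ℤ) ≤ n₁ + n₂ →
      pairing a (-(n₁ + n₂)) κ n₁ n₂ m = 0 := by
  have hs : 1 - a ≠ 0 := sub_ne_zero.mpr ha1.symm
  have hα : (1 - a)⁻¹ ≠ 0 := inv_ne_zero hs
  have hβ : a / (1 - a) ≠ 0 := div_ne_zero ha0 hs
  refine ⟨-((a / (1 - a)) ^ (n₁ + n₂) * (-((1 - a)⁻¹ * (a / (1 - a)))) ^ (-n₂)), ?_, ?_⟩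
  · exact neg_ne_zero.mpr (mul_ne_zero (zpow_ne_zero _ hβ)
      (zpow_ne_zero _ (neg_ne_zero.mpr (mul_ne_zero hα hβ))))
  · intro m hm
    obtain ⟨m', hm'⟩ := Int.le.dest hm
    have h := eval_meixner_reflect a ha0 ha1 m m' n₁ n₂ hm'.symm
    have e : (-((m : ℝ) + m')) = -((n₁ : ℝ) + n₂) := by
      have := congrArg (Int.cast (R := ℝ)) hm'
      push_cast at this
      rw [this]
    rw [e] at h
    have e2 : (1 - a)⁻¹ ^ m = (a / (1 - a)) ^ m * a⁻¹ ^ m := by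
      rw [← mul_pow]; congr 1; field_simp
    rw [pairing, h, e2, ← hm', zpow_add₀ hβ, zpow_natCast, zpow_natCast]
    ring

lemma sum_pairing (a c c' κ : ℝ) (ha0 : a ≠ 0) (F : Finset ℕ) (i j : ℕ) :
    ∑ s, C κ * (shift j (meixner a c' (topCount F - 1 - elt F s : ℕ))).comp (-X) *
        shift i (meixner a c (elt F s)) +
      ∑ s, C κ * (shift j (meixner a c' (elt (invol F) s))).comp (-X) *
        shift i (meixner a c (topCount F - 1 - elt (invol F) s : ℕ)) =
      C (κ * (meixner a (c + c') ((topCount F : ℤ) - 1)).eval (((i + j : ℕ) : ℝ))) := by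
  have h := sum_add_sum_invol F (fun f => shift i (meixner a c f) *
    (shift j (meixner a c' (topCount F - 1 - f : ℕ))).comp (-X))
  rw [sum_meixner_shift a c c' ha0] at h
  rw [C_mul, ← h, mul_add, Finset.mul_sum, Finset.mul_sum]
  congr 1
  · exact Finset.sum_congr rfl fun s _ => by ring
  · refine Finset.sum_congr rfl fun s _ => ?_
    have := (mem_invol.mp (elt_mem (invol F) s)).1
    rw [show topCount F - 1 - (topCount F - 1 - elt (invol F) s) = elt (invol F) s by omega]
    ring

/-- The Casoratian of `F` is, up to a nonzero factor, the reflected Casoratian of `I(F)`: both are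
complementary minors of the matrix of all rows of index at most `max F₁`, `max F₂` and of its
inverse transpose, which is again made of Meixner polynomials. -/
theorem exists_casoratian_invol (a c : ℝ) (ha0 : a ≠ 0) (ha1 : a ≠ 1) (F₁ F₂ : Finset ℕ) :
    ∃ κ : ℝ, κ ≠ 0 ∧ (casoratian a (-c - (maxInt F₁ : ℝ) - (maxInt F₂ : ℝ)) (invol F₁)
      (invol F₂)).comp (-X) = C κ * casoratian a c F₁ F₂ := by
  set c' : ℝ := -c - (maxInt F₁ : ℝ) - (maxInt F₂ : ℝ) with hc'
  have hb0 := inv_ne_zero ha0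
  have hb1 := inv_ne_one_of_ne_one ha1
  obtain ⟨hd0, hd1⟩ := one_div_ne_zero_and_ne_one ha0 ha1
  obtain ⟨κ, hκ, hpair⟩ := exists_pairing_eq_zero a ha0 ha1 (maxInt F₁) (maxInt F₂)
  have hcc : -((maxInt F₁ : ℝ) + (maxInt F₂ : ℝ)) = c + c' := by rw [hc']; ring
  rw [hcc] at hpair
  set ρ : Fin (F₁.card + F₂.card) ⊕ Fin ((invol F₁).card + (invol F₂).card) → ℝ :=
    Sum.elim (rowTwist a F₁ F₂) (rowTwist a (invol F₁) (invol F₂)) with hρ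
  set φ : Fin (F₁.card + F₂.card) ⊕ Fin ((invol F₁).card + (invol F₂).card) → ℝ[X] :=
    Sum.elim (rowPoly a c F₁ F₂) (Fin.append
      (fun i => meixner a c (topCount F₁ - 1 - elt (invol F₁) i : ℕ))
      (fun i => meixner (1 / a) c (topCount F₂ - 1 - elt (invol F₂) i : ℕ))) with hφ
  set ψ : Fin (F₁.card + F₂.card) ⊕ Fin ((invol F₁).card + (invol F₂).card) → ℝ[X] :=
    Sum.elim (Fin.append
      (fun i => meixner a c' (topCount F₁ - 1 - elt F₁ i : ℕ))
      (fun i => meixner (1 / a) c' (topCount F₂ - 1 - elt F₂ i : ℕ)))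
      (rowPoly a c' (invol F₁) (invol F₂)) with hψ
  set J : Fin (F₁.card + F₂.card) ⊕ Fin ((invol F₁).card + (invol F₂).card) → ℝ :=
    Sum.elim (Fin.append (fun _ => 1) (fun _ => κ)) (Fin.append (fun _ => 1) (fun _ => κ)) with hJ
  have hsum : ∀ i j : ℕ, ∑ s, C (J s) * ((twShift (ρ s) ^ j) (ψ s)).comp (-X) *
      (twShift (ρ s) ^ i) (φ s) =
      C (pairing a (c + c') κ (maxInt F₁) (maxInt F₂) (i + j)) := by
    intro i j
    have h1 := sum_pairing a c c' 1 ha0 F₁ i j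
    have h2 := sum_pairing (1 / a) c c' (κ * a⁻¹ ^ (i + j)) hd0 F₂ i j
    rw [pairing, maxInt_eq, maxInt_eq, C_add, ← mul_assoc, ← h2, ← one_mul (eval _ _), ← h1]
    simp only [Fintype.sum_sum_type, Fin.sum_univ_add, hρ, hφ, hψ, hJ, Sum.elim_inl, Sum.elim_inr,
      rowTwist, rowPoly, Fin.append_left, Fin.append_right, twShift_pow_apply, mul_comp, C_comp,
      one_pow, C_1, one_mul, C_mul, pow_add]
    rw [add_add_add_comm]
    refine congrArg₂ _ rfl (congrArg₂ _ ?_ ?_) <;>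
    exact Finset.sum_congr rfl fun s _ => by ring
  set A : Matrix (Fin (F₁.card + F₂.card) ⊕ Fin ((invol F₁).card + (invol F₂).card))
    (Fin (F₁.card + F₂.card) ⊕ Fin ((invol F₁).card + (invol F₂).card)) ℝ[X] :=
    Matrix.of fun s t => (twShift (ρ s) ^ (finSumFinEquiv t : ℕ)) (φ s) with hA
  set B : Matrix (Fin (F₁.card + F₂.card) ⊕ Fin ((invol F₁).card + (invol F₂).card))
    (Fin ((invol F₁).card + (invol F₂).card)) ℝ[X] :=
    Matrix.of fun s j => C (J s) * ((twShift (ρ s) ^ (j : ℕ)) (ψ s)).comp (-X) with hB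
  set H : Matrix (Fin ((invol F₁).card + (invol F₂).card))
    (Fin ((invol F₁).card + (invol F₂).card)) ℝ :=
    Matrix.of fun j t => pairing a (c + c') κ (maxInt F₁) (maxInt F₂)
      (F₁.card + F₂.card + t + j) with hH
  have hcard₁ := card_add_card_invol F₁
  have hcard₂ := card_add_card_invol F₂
  have hBA : B.transpose * A = Matrix.fromCols 0 (H.map C) := by
    ext1 j t
    rw [Matrix.mul_apply]
    simp only [hA, hB, Matrix.transpose_apply, Matrix.of_apply, hsum]
    rcases t with t | t
    · rw [hpair]
      · simp
      · have := t.2; have := j.2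
        rw [maxInt_eq, maxInt_eq]
        simp only [finSumFinEquiv_apply_left, Fin.val_castAdd]
        omega
    · simp [hH]
  have hdet := det_toBlocks_mul_det A B (H.map C) hBA
  have hHdet : (H.map C).det = C H.det := by
    rw [← RingHom.mapMatrix_apply, ← RingHom.map_det]
  have hA11 : A.toBlocks₁₁.det = casoratian a c F₁ F₂ := by
    rw [casoratian_eq]
    rfl
  have hB2 : (Matrix.of fun s t => B (Sum.inr s) t).det =
      C (∏ s, J (Sum.inr s)) * (casoratian a c' (invol F₁) (invol F₂)).comp (-X) := by
    rw [casoratian_eq, ← coe_compRingHom_apply, RingHom.map_det, map_prod,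
      ← Matrix.det_mul_column]
    rfl
  -- The full matrix has a nonzero constant determinant.
  have hAdet : ∃ δ : ℝ, δ ≠ 0 ∧ A.det = C δ := by
    have hdeg : ∀ s, φ s ≠ 0 ∧ (φ s).natDegree = Sum.elim (Fin.append (elt F₁) (elt F₂))
        (Fin.append (fun i => topCount F₁ - 1 - elt (invol F₁) i)
          (fun i => topCount F₂ - 1 - elt (invol F₂) i)) s := by
      rintro (s | s)
      · exact natDegree_rowPoly a c ha0 ha1 F₁ F₂ s
      · refine Fin.addCases (fun s => ?_) (fun s => ?_) s <;>
          simp only [hφ, Sum.elim_inr, Fin.append_left, Fin.append_right]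
        · exact ⟨meixner_ne_zero _ _ ha0 ha1 _, natDegree_meixner _ _ ha0 ha1 _⟩
        · exact ⟨meixner_ne_zero _ _ hd0 hd1 _, natDegree_meixner _ _ hd0 hd1 _⟩
    have hmem : ∀ (F : Finset ℕ) i i', elt F i ≠ topCount F - 1 - elt (invol F) i' := by
      intro F i i' h
      exact (mem_invol.mp (elt_mem (invol F) i')).2 (h ▸ elt_mem F i)
    have hrefl : ∀ (F : Finset ℕ) i i', topCount F - 1 - elt (invol F) i =
        topCount F - 1 - elt (invol F) i' → i = i' := by
      intro F i i' h
      have := (mem_invol.mp (elt_mem (invol F) i)).1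
      have := (mem_invol.mp (elt_mem (invol F) i')).1
      exact elt_injective _ (by omega)
    have hρ' : ∀ s, ρ s = 1 ∨ ρ s = a⁻¹ := by
      rintro (s | s)
      · exact rowTwist_eq _ _ _ _
      · exact rowTwist_eq _ _ _ _
    have hinj : ∀ s t, ρ s = ρ t → (φ s).natDegree = (φ t).natDegree → s = t := by
      intro s t h h'
      rw [(hdeg s).2, (hdeg t).2] at h'
      rcases s with s | s <;> rcases t with t | t <;> revert h h' <;>
        refine Fin.addCases (fun s => ?_) (fun s => ?_) s <;>
        refine Fin.addCases (fun t => ?_) (fun t => ?_) t <;>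
        simp only [hρ, rowTwist, Sum.elim_inl, Sum.elim_inr, Fin.append_left, Fin.append_right] <;>
        intro h h'
      all_goals first
        | exact absurd h hb1
        | exact absurd h.symm hb1
        | exact absurd h' (hmem _ _ _)
        | exact absurd h'.symm (hmem _ _ _)
        | rw [elt_injective _ h']
        | rw [hrefl _ _ _ h']
    have hone : ∑ s, (if ρ s = 1 then 1 else 0) = topCount F₁ := by
      rw [Fintype.sum_sum_type]
      simp only [hρ, Sum.elim_inl, Sum.elim_inr, sum_rowTwist ha1]
      exact hcard₁
    obtain ⟨h1, h2⟩ := casoratian_ne_zero_and_natDegree a⁻¹ hb0 hb1 (k₁ := topCount F₁)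
      (k₂ := topCount F₂) finSumFinEquiv ρ φ hρ' (fun s => (hdeg s).1) hinj hone (by omega)
    refine ⟨A.det.coeff 0, ?_⟩
    have h3 : A.det.natDegree = 0 := by
      have e : ∑ s, (φ s).natDegree = ∑ f ∈ Finset.range (topCount F₁), f +
          ∑ f ∈ Finset.range (topCount F₂), f := by
        rw [← sum_add_sum_invol F₁ (fun f => f), ← sum_add_sum_invol F₂ (fun f => f)]
        simp only [hdeg, Fintype.sum_sum_type, Fin.sum_univ_add, Sum.elim_inl, Sum.elim_inr,
          Fin.append_left, Fin.append_right]
        omega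
      rw [e, Finset.sum_range_id, Finset.sum_range_id, ← Nat.choose_two_right,
        ← Nat.choose_two_right] at h2
      simp only [hA]
      omega
    have h4 := eq_C_of_natDegree_eq_zero h3
    refine ⟨fun h => ?_, h4⟩
    rw [h, C_0] at h4
    exact h1 h4
  obtain ⟨δ, hδ, hAδ⟩ := hAdet
  rw [hA11, hHdet, hB2, hAδ] at hdet
  have hJ0 : ∏ s, J (Sum.inr s) ≠ 0 := by
    refine Finset.prod_ne_zero_iff.mpr fun s _ => ?_
    refine Fin.addCases (fun s => ?_) (fun s => ?_) s <;> simp [hJ, hκ]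
  have hG : (casoratian a c' (invol F₁) (invol F₂)).comp (-X) ≠ 0 := by
    intro h0
    have := congrArg (fun p => p.comp (-X)) h0
    simp only [comp_assoc, neg_comp, X_comp, neg_neg, comp_X, zero_comp] at this
    exact (natDegree_casoratian a c' ha0 ha1 _ _).1 this
  have hH0 : H.det ≠ 0 := by
    intro h0
    rw [h0, C_0, mul_zero] at hdet
    exact mul_ne_zero (mul_ne_zero (C_ne_zero.mpr hJ0) hG) (C_ne_zero.mpr hδ) hdet.symm
  refine ⟨(∏ s, J (Sum.inr s))⁻¹ * δ⁻¹ * H.det, by positivity, ?_⟩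
  have u1 : C (∏ s, J (Sum.inr s))⁻¹ * C (∏ s, J (Sum.inr s)) = (1 : ℝ[X]) := by
    rw [← C_mul, inv_mul_cancel₀ hJ0, C_1]
  have u2 : C δ⁻¹ * C δ = (1 : ℝ[X]) := by rw [← C_mul, inv_mul_cancel₀ hδ, C_1]
  rw [C_mul, C_mul]
  set P := C (∏ s, J (Sum.inr s))
  set P' := C (∏ s, J (Sum.inr s))⁻¹
  set W := (casoratian a c' (invol F₁) (invol F₂)).comp (-X)
  linear_combination (-P' * C δ⁻¹) * hdet - W * u1 - W * P' * P * u2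

/-! ### The intertwining relation -/

/-- The translation `x ↦ x + 1` on the coefficients of polynomials in a symbol `S` over `ℝ[x]`. -/
noncomputable def coeffShift : ℝ[X][X] →+* ℝ[X][X] :=
  mapRingHom (taylorAlgHom (1 : ℝ) : ℝ[X] →ₐ[ℝ] ℝ[X]).toRingHom

lemma coeffShift_C (p : ℝ[X]) : coeffShift (C p) = C (taylor 1 p) := by
  simp [coeffShift]

lemma coeffShift_X : coeffShift X = X := by simp [coeffShift]

lemma taylor_one_C (t : ℝ) : taylor 1 (C t) = C t := by simp [taylor_apply]

lemma coeffShift_map_C (E : ℝ[X]) : coeffShift (E.map C) = E.map C := by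
  rw [coeffShift, coe_mapRingHom, map_map]
  congr 1
  ext t : 1
  exact taylor_one_C t

lemma coeffShift_pow_succ (l : ℕ) (r : ℝ[X][X]) :
    (coeffShift ^ (l + 1)) r = coeffShift ((coeffShift ^ l) r) := by
  rw [pow_succ', RingHom.mul_def, RingHom.comp_apply]

lemma coeff_coeffShift_iterate (l m : ℕ) (r : ℝ[X][X]) :
    ((coeffShift ^ l) r).coeff m = (twShift 1 ^ l) (r.coeff m) := by
  induction l with
  | zero => rfl
  | succ l ih =>
    rw [coeffShift_pow_succ, pow_succ', Module.End.mul_apply, ← ih, coeffShift, coe_mapRingHom,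
      coeff_map]
    simp [twShift]

/-- The inhomogeneous equation `S Y(x + 1) - ρ Y(x) = (S - ρ)^e g(x)`, which inverts the difference
operator on the formal function `(S / ρ)^x g(x)`, is solvable once `e` exceeds the degree in `x`. -/
lemma exists_sub_eq_of_degree_lt (ρ : ℝ) (d : ℕ) : ∀ p : ℝ[X], p.degree < d →
    ∃ Y : ℝ[X][X], X * coeffShift Y - C (C ρ) * Y = (X - C (C ρ)) ^ d * C p := by
  induction d with
  | zero =>
    intro p hp
    have : p = 0 := by
      exact degree_eq_bot.mp (Nat.WithBot.lt_zero_iff.mp hp)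
    exact ⟨0, by simp [this]⟩
  | succ d ih =>
    intro p hp
    have hΔ : (taylor 1 p - p).degree < d := by
      have hp' : p.natDegree ≤ d := by
        by_cases h0 : p = 0
        · simp [h0]
        · exact Nat.lt_succ_iff.mp ((natDegree_lt_iff_degree_lt h0).mpr hp)
      have e : taylor 1 p - p = twShift 1 p - (1 : ℝ) • p := by simp [twShift]
      rw [e]
      rcases d with _ | d
      · rw [twShift_of_natDegree_zero 1 p hp', degree_zero]
        exact WithBot.bot_lt_coe 0
      · refine lt_of_le_of_lt (natDegree_le_iff_degree_le.mp
          (natDegree_twShift_sub_le 1 p d hp').1) ?_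
        exact_mod_cast Nat.lt_succ_self d
    obtain ⟨Y, hY⟩ := ih _ hΔ
    refine ⟨(X - C (C ρ)) ^ d * C p - X * Y, ?_⟩
    have hρ : coeffShift (X - C (C ρ)) = X - C (C ρ) := by
      rw [map_sub, coeffShift_X, coeffShift_C, taylor_one_C]
    rw [map_sub, map_mul, map_mul, map_pow, hρ, coeffShift_C, coeffShift_X, pow_succ]
    rw [C_sub] at hY
    linear_combination (-X) * hY

lemma exists_sub_eq (ρ : ℝ) (g : ℝ[X][X]) : ∃ e₀ : ℕ, ∀ e ≥ e₀,
    ∃ Y : ℝ[X][X], X * coeffShift Y - C (C ρ) * Y = (X - C (C ρ)) ^ e * g := by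
  induction g using Polynomial.induction_on' with
  | add p q hp hq =>
    obtain ⟨e₁, h₁⟩ := hp
    obtain ⟨e₂, h₂⟩ := hq
    refine ⟨max e₁ e₂, fun e he => ?_⟩
    obtain ⟨Y₁, hY₁⟩ := h₁ e (le_trans (le_max_left _ _) he)
    obtain ⟨Y₂, hY₂⟩ := h₂ e (le_trans (le_max_right _ _) he)
    refine ⟨Y₁ + Y₂, ?_⟩
    rw [map_add]
    linear_combination hY₁ + hY₂
  | monomial m p =>
    refine ⟨p.natDegree + 1, fun e he => ?_⟩
    obtain ⟨Y, hY⟩ := exists_sub_eq_of_degree_lt ρ e p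
      (lt_of_le_of_lt degree_le_natDegree (by exact_mod_cast he))
    refine ⟨X ^ m * Y, ?_⟩
    rw [map_mul, map_pow, coeffShift_X, ← C_mul_X_pow_eq_monomial]
    linear_combination X ^ m * hY

/-- Variation of constants. If the difference of `λ` is a multiple of the Casoratian of the `φ i`,
then `λ f` can be corrected by multiples of the `φ i`, for the formal function `f = S ^ x`, so that
after `l ≤ k` translations the corrections are still the translates of the `φ i` times the initial
coefficients. The factor `E` clears the denominators `S - ρ i`. -/
lemma exists_variation_of_constants {k : ℕ} (ρ : Fin k → ℝ) (φ : Fin k → ℝ[X]) (lam : ℝ[X])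
    (κ : ℝ) (hlam : taylor 1 lam - lam = C κ * taylor 1
      (Matrix.of fun i l : Fin k => (twShift (ρ i) ^ (l : ℕ)) (φ i)).det) :
    ∃ e₀ : ℕ, ∀ e ≥ e₀, ∀ E : ℝ[X], (∀ i, (X - C (ρ i)) ^ e ∣ E) →
      ∃ (r : ℝ[X][X]) (Y : Fin k → ℝ[X][X]), ∀ l ≤ k,
        X ^ l * (coeffShift ^ l) r = C lam * X ^ l * E.map C -
          ∑ i, C ((twShift (ρ i) ^ l) (φ i)) * Y i := by
  set M : Matrix (Fin k) (Fin k) ℝ[X] :=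
    Matrix.of fun i l : Fin k => (twShift (ρ i) ^ (l : ℕ)) (φ i) with hM
  set v : Fin k → ℝ[X][X] := fun l => X ^ (l : ℕ) with hv
  set P : Fin k → ℝ[X][X] := Matrix.vecMul v ((M.map C).adjugate) with hP
  -- Cramer's rule expresses the translates of `S ^ x` through those of the `φ i`.
  have hcramer : ∀ m < k, ∑ i, C ((twShift (ρ i) ^ m) (φ i)) * P i = C M.det * X ^ m := by
    intro m hm
    have h : Matrix.vecMul P (M.map C) = (M.map C).det • v := by
      rw [hP, Matrix.vecMul_vecMul, Matrix.adjugate_mul, Matrix.vecMul_smul, Matrix.vecMul_one]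
    have h' := congrFun h ⟨m, hm⟩
    rw [← RingHom.mapMatrix_apply, ← RingHom.map_det, Pi.smul_apply, smul_eq_mul] at h'
    rw [← h', Matrix.vecMul, dotProduct]
    exact Finset.sum_congr rfl fun i _ => mul_comm _ _
  choose e₀ he₀ using fun i => exists_sub_eq (ρ i) (C (C κ) * X * coeffShift (P i))
  refine ⟨∑ i, e₀ i, fun e he E hE => ?_⟩
  have hYex : ∀ i, ∃ Y : ℝ[X][X], X * coeffShift Y - C (C (ρ i)) * Y =
      E.map C * (C (C κ) * X * coeffShift (P i)) := by
    intro i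
    obtain ⟨Y, hY⟩ := he₀ i e
      (le_trans (Finset.single_le_sum (fun _ _ => Nat.zero_le _) (Finset.mem_univ i)) he)
    obtain ⟨E', hE'⟩ := hE i
    refine ⟨E'.map C * Y, ?_⟩
    rw [map_mul, coeffShift_map_C, hE', Polynomial.map_mul, Polynomial.map_pow,
      Polynomial.map_sub, map_X, map_C]
    linear_combination E'.map C * hY
  choose Y hY using hYex
  set Z : ℕ → ℝ[X][X] := fun m =>
    C lam * X ^ m * E.map C - ∑ i, C ((twShift (ρ i) ^ m) (φ i)) * Y i with hZ
  have hstep : ∀ m < k, X * coeffShift (Z m) = Z (m + 1) := by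
    intro m hm
    have h1 := congrArg coeffShift (hcramer m hm)
    simp only [map_sum, map_mul, coeffShift_C, map_pow, coeffShift_X] at h1
    have h2 : ∀ i, C (taylor 1 ((twShift (ρ i) ^ m) (φ i))) * (X * coeffShift (Y i)) =
        C ((twShift (ρ i) ^ (m + 1)) (φ i)) * Y i + E.map C * C (C κ) * X *
          (C (taylor 1 ((twShift (ρ i) ^ m) (φ i))) * coeffShift (P i)) := by
      intro i
      have h3 : (twShift (ρ i) ^ (m + 1)) (φ i) =
          C (ρ i) * taylor 1 ((twShift (ρ i) ^ m) (φ i)) := by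
        rw [pow_succ', Module.End.mul_apply, twShift_apply, taylor_apply, C_1]
      rw [h3, C_mul]
      linear_combination C (taylor 1 ((twShift (ρ i) ^ m) (φ i))) * hY i
    have h4 := congrArg (C : ℝ[X] → ℝ[X][X]) hlam
    rw [C_sub, C_mul] at h4
    have h5 : X * ∑ i, C (taylor 1 ((twShift (ρ i) ^ m) (φ i))) * coeffShift (Y i) =
        ∑ i, C ((twShift (ρ i) ^ (m + 1)) (φ i)) * Y i + E.map C * C (C κ) * X *
          (C (taylor 1 M.det) * X ^ m) := by
      rw [← h1, Finset.mul_sum, Finset.mul_sum, ← Finset.sum_add_distrib]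
      refine Finset.sum_congr rfl fun i _ => ?_
      rw [← h2 i]; ring
    simp only [hZ, map_sub, map_mul, map_sum, map_pow, coeffShift_C, coeffShift_X,
      coeffShift_map_C]
    rw [mul_sub, h5]
    linear_combination X ^ (m + 1) * E.map C * h4
  have hiter : ∀ l ≤ k, X ^ l * (coeffShift ^ l) (Z 0) = Z l := by
    intro l
    clear_value Z
    induction l with
    | zero => intro _; rw [pow_zero, pow_zero, one_mul]; rfl
    | succ l ih =>
      intro hl
      rw [coeffShift_pow_succ l (Z 0), ← hstep l (by omega), ← ih (by omega), map_mul, map_pow,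
        coeffShift_X, pow_succ' X l, mul_assoc]
  exact ⟨Z 0, Y, hiter⟩

/-- The operator on polynomials with symbol `r = ∑ r_m(x) S^m`: multiplication by the coefficients
after the powers of the twisted shift. -/
noncomputable def symbolOp (θ : ℝ) (r : ℝ[X][X]) : Module.End ℝ ℝ[X] :=
  eval₂ (Algebra.lmul ℝ ℝ[X]).toRingHom (twShift θ) r

lemma lmul_apply_apply (p q : ℝ[X]) : Algebra.lmul ℝ ℝ[X] p q = p * q := rfl

lemma symbolOp_add (θ : ℝ) (r s : ℝ[X][X]) :
    symbolOp θ (r + s) = symbolOp θ r + symbolOp θ s := eval₂_add _ _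

lemma symbolOp_monomial (θ : ℝ) (m : ℕ) (p : ℝ[X]) :
    symbolOp θ (monomial m p) = Algebra.lmul ℝ ℝ[X] p * twShift θ ^ m := eval₂_monomial _ _

lemma symbolOp_sum {ι : Type*} (θ : ℝ) (s : Finset ι) (g : ι → ℝ[X][X]) :
    symbolOp θ (∑ i ∈ s, g i) = ∑ i ∈ s, symbolOp θ (g i) := eval₂_finsetSum _ _ _ _

lemma symbolOp_map_C (θ : ℝ) (E : ℝ[X]) : symbolOp θ (E.map C) = aeval (twShift θ) E := by
  rw [symbolOp, eval₂_map, aeval_def]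
  congr 1
  ext t : 1
  exact (Algebra.lmul ℝ ℝ[X]).commutes t

lemma twShift_pow_mul_lmul (θ : ℝ) (l : ℕ) (p : ℝ[X]) :
    twShift θ ^ l * Algebra.lmul ℝ ℝ[X] p =
      Algebra.lmul ℝ ℝ[X] ((twShift 1 ^ l) p) * twShift θ ^ l := by
  induction l generalizing p with
  | zero => simp
  | succ l ih =>
    have h : twShift θ * Algebra.lmul ℝ ℝ[X] p =
        Algebra.lmul ℝ ℝ[X] (twShift 1 p) * twShift θ := by
      refine LinearMap.ext fun q => ?_
      rw [Module.End.mul_apply, Module.End.mul_apply, lmul_apply_apply, lmul_apply_apply,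
        twShift_mul]
      simp [twShift]
    rw [pow_succ, mul_assoc, h, ← mul_assoc, ih, pow_succ (twShift 1), Module.End.mul_apply,
      mul_assoc]

/-- Composition of operators in terms of symbols. -/
lemma symbolOp_C_mul_X_pow_mul (θ : ℝ) (p : ℝ[X]) (l : ℕ) (r : ℝ[X][X]) :
    symbolOp θ (C p * X ^ l * (coeffShift ^ l) r) =
      Algebra.lmul ℝ ℝ[X] p * twShift θ ^ l * symbolOp θ r := by
  induction r using Polynomial.induction_on' with
  | add r s hr hs => rw [map_add, mul_add, symbolOp_add, symbolOp_add, hr, hs, mul_add]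
  | monomial m q =>
    have h : (coeffShift ^ l) (monomial m q) = monomial m ((twShift 1 ^ l) q) := by
      ext1 j
      rw [coeff_coeffShift_iterate, coeff_monomial, coeff_monomial]
      split_ifs <;> simp
    rw [h, C_mul_X_pow_eq_monomial, monomial_mul_monomial, symbolOp_monomial, symbolOp_monomial,
      mul_assoc _ (twShift θ ^ l), ← mul_assoc (twShift θ ^ l), twShift_pow_mul_lmul, map_mul,
      pow_add]
    simp only [mul_assoc]

lemma coeffShift_pow_map_C (l : ℕ) (E : ℝ[X]) : (coeffShift ^ l) (E.map C) = E.map C := by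
  induction l with
  | zero => rfl
  | succ l ih => rw [coeffShift_pow_succ, ih, coeffShift_map_C]

/-- The difference operator `p(x) ↦ ∑_l d_l(x) θ^l p(x + l)`. -/
noncomputable def diffOp {K : ℕ} (d : Fin K → ℝ[X]) (θ : ℝ) : Module.End ℝ ℝ[X] :=
  ∑ l, Algebra.lmul ℝ ℝ[X] (d l) * twShift θ ^ (l : ℕ)

/-- If the operator with coefficients `d` annihilates the `φ i`, then multiplication by `λ` is
carried, through that operator, to a difference operator `r` divided by `E`. -/
theorem exists_intertwiner {k : ℕ} (ρ : Fin k → ℝ) (φ : Fin k → ℝ[X]) (lam : ℝ[X])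
    (κ : ℝ) (hlam : taylor 1 lam - lam = C κ * taylor 1
      (Matrix.of fun i l : Fin k => (twShift (ρ i) ^ (l : ℕ)) (φ i)).det)
    (d : Fin (k + 1) → ℝ[X]) (hd : ∀ i, diffOp d (ρ i) (φ i) = 0) (hd0 : d (Fin.last k) ≠ 0) :
    ∃ e₀ : ℕ, ∀ e ≥ e₀, ∀ E : ℝ[X], (∀ i, (X - C (ρ i)) ^ e ∣ E) →
      ∃ r : ℝ[X][X], r.natDegree ≤ E.natDegree ∧ ∀ θ : ℝ,
        diffOp d θ * symbolOp θ r =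
          Algebra.lmul ℝ ℝ[X] lam * diffOp d θ * aeval (twShift θ) E := by
  obtain ⟨e₀, he₀⟩ := exists_variation_of_constants ρ φ lam κ hlam
  refine ⟨e₀, fun e he E hE => ?_⟩
  obtain ⟨r, Y, hr⟩ := he₀ e he E hE
  have hsymb : ∑ l : Fin (k + 1), C (d l) * X ^ (l : ℕ) * (coeffShift ^ (l : ℕ)) r =
      C lam * ∑ l : Fin (k + 1), C (d l) * X ^ (l : ℕ) * E.map C := by
    have h1 : ∑ l : Fin (k + 1), C (d l) * ∑ i, C ((twShift (ρ i) ^ (l : ℕ)) (φ i)) * Y i = 0 := by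
      simp only [Finset.mul_sum]
      rw [Finset.sum_comm]
      refine Finset.sum_eq_zero fun i _ => ?_
      have h2 := congrArg (fun p => C p * Y i) (hd i)
      simp only [diffOp, LinearMap.sum_apply, Module.End.mul_apply, lmul_apply_apply, map_sum,
        map_mul, map_zero, zero_mul, Finset.sum_mul] at h2
      simpa only [mul_assoc] using h2
    rw [← sub_zero (C lam * _), ← h1, Finset.mul_sum, ← Finset.sum_sub_distrib]
    refine Finset.sum_congr rfl fun l _ => ?_
    rw [mul_assoc, hr l (Nat.lt_succ_iff.mp l.2)]
    ring
  refine ⟨r, ?_, fun θ => ?_⟩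
  · -- Compare the coefficients of the highest power of `S`.
    by_contra! hlt
    have hr0 : r.leadingCoeff ≠ 0 := by
      intro h
      rw [leadingCoeff_eq_zero.mp h, natDegree_zero] at hlt
      omega
    have hc := congrArg (fun q => coeff q (k + r.natDegree)) hsymb
    rw [finsetSum_coeff] at hc
    have hE : ∀ l : Fin (k + 1), (C (d l) * X ^ (l : ℕ) * E.map C).natDegree ≤
        k + E.natDegree := by
      intro l
      refine natDegree_mul_le_of_le ((natDegree_C_mul_X_pow_le _ _).trans
        (Nat.lt_succ_iff.mp l.2)) natDegree_map_le
    have hright : (C lam * ∑ l : Fin (k + 1), C (d l) * X ^ (l : ℕ) * E.map C).coeff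
        (k + r.natDegree) = 0 := by
      refine coeff_eq_zero_of_natDegree_lt (lt_of_le_of_lt ((natDegree_C_mul_le _ _).trans
        (natDegree_sum_le_of_forall_le _ _ fun l _ => hE l)) (by omega))
    rw [hright, Fin.sum_univ_castSucc, Finset.sum_eq_zero, zero_add, mul_assoc, coeff_C_mul,
      Fin.val_last, add_comm k, coeff_X_pow_mul, coeff_coeffShift_iterate, twShift_pow_apply] at hc
    · rcases mul_eq_zero.mp hc with h | h
      · exact hd0 h
      · rw [one_pow, C_1, one_mul, shift, ← taylor_apply] at h
        exact hr0 (taylor_injective _ (h.trans (map_zero _).symm))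
    · intro l _
      rw [mul_assoc, coeff_C_mul, coeff_X_pow_mul', if_pos (by have := l.2; simp; omega),
        coeff_coeffShift_iterate, coeff_eq_zero_of_natDegree_lt, map_zero, mul_zero]
      have := l.2
      simp only [Fin.val_castSucc]
      omega
  · have h := congrArg (symbolOp θ) hsymb
    rw [symbolOp_sum, Finset.sum_congr rfl fun l _ => symbolOp_C_mul_X_pow_mul θ (d l) l r,
      ← Finset.sum_mul] at h
    have h2 := symbolOp_C_mul_X_pow_mul θ lam 0
      (∑ l : Fin (k + 1), C (d l) * X ^ (l : ℕ) * E.map C)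
    have h3 : symbolOp θ (∑ l : Fin (k + 1), C (d l) * X ^ (l : ℕ) * E.map C) =
        diffOp d θ * aeval (twShift θ) E := by
      rw [symbolOp_sum, diffOp, Finset.sum_mul]
      refine Finset.sum_congr rfl fun l _ => ?_
      rw [← symbolOp_map_C, ← symbolOp_C_mul_X_pow_mul, coeffShift_pow_map_C]
    simp only [pow_zero, mul_one, RingHom.one_def, RingHom.id_apply] at h2
    rw [h2, h3] at h
    rw [mul_assoc]
    exact h

/-! ### Recurrence operators with polynomial coefficients -/

/-- An operator on polynomials, applied termwise to sequences of polynomials. -/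
noncomputable def termwise : Module.End ℝ ℝ[X] →ₐ[ℝ] Module.End ℝ (ℤ → ℝ[X]) where
  toFun f := f.compLeft ℤ
  map_one' := rfl
  map_mul' _ _ := rfl
  map_zero' := rfl
  map_add' _ _ := rfl
  commutes' _ := rfl

lemma termwise_apply (f : Module.End ℝ ℝ[X]) (ψ : ℤ → ℝ[X]) (n : ℤ) :
    termwise f ψ n = f (ψ n) := rfl

/-- The operator `ψ_n ↦ p(n + ν) ψ_{n + j}` on sequences. -/
noncomputable def recTerm (j : ℤ) (p : ℝ[X]) (ν : ℝ) : Module.End ℝ (ℤ → ℝ[X]) where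
  toFun ψ n := p.eval ((n : ℝ) + ν) • ψ (n + j)
  map_add' ψ χ := by ext1 n; simp [smul_add]
  map_smul' t ψ := by ext1 n; simp [smul_comm t]

/-- The recurrence operator `ψ_n ↦ ∑_j b_j(n + ν) ψ_{n + j}`, as a function of the offset `ν`. -/
noncomputable def recOp : (ℤ →₀ ℝ[X]) →ₗ[ℝ] (ℝ → Module.End ℝ (ℤ → ℝ[X])) :=
  Finsupp.lsum ℝ fun j =>
    { toFun := fun p ν => recTerm j p ν
      map_add' := fun p q => by
        ext1 ν; refine LinearMap.ext fun ψ => funext fun n => ?_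
        simp [recTerm, add_smul]
      map_smul' := fun t p => by
        ext1 ν; refine LinearMap.ext fun ψ => funext fun n => ?_
        simp [recTerm, mul_smul] }

lemma recOp_single (j : ℤ) (p : ℝ[X]) : recOp (Finsupp.single j p) = recTerm j p := by
  rw [recOp, Finsupp.lsum_single]
  rfl

lemma recOp_apply (b : ℤ →₀ ℝ[X]) (ν : ℝ) (ψ : ℤ → ℝ[X]) (n : ℤ) :
    recOp b ν ψ n = b.sum fun j p => p.eval ((n : ℝ) + ν) • ψ (n + j) := by
  rw [recOp, Finsupp.lsum_apply, Finsupp.sum, Finsupp.sum, Finset.sum_apply, LinearMap.sum_apply,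
    Finset.sum_apply]
  rfl

lemma recTerm_mul (i j : ℤ) (p q : ℝ[X]) :
    recTerm i p * recTerm j q = recTerm (i + j) (p * q.comp (X + C (i : ℝ))) := by
  ext1 ν
  refine LinearMap.ext fun ψ => funext fun n => ?_
  simp only [recTerm, Pi.mul_apply, Module.End.mul_apply, LinearMap.coe_mk, AddHom.coe_mk,
    eval_mul, eval_comp, eval_add, eval_X, eval_C, smul_smul, Int.cast_add]
  rw [add_right_comm (n : ℝ), add_assoc n]

/-- The algebra of recurrence operators with polynomial coefficients. -/
noncomputable def recAlg : Subalgebra ℝ (ℝ → Module.End ℝ (ℤ → ℝ[X])) :=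
  (LinearMap.range recOp).toSubalgebra
    ⟨Finsupp.single 0 1, by
      rw [recOp_single]
      ext1 ν
      refine LinearMap.ext fun ψ => funext fun n => ?_
      simp [recTerm]⟩
    (by
      rintro _ _ ⟨b, rfl⟩ ⟨b', rfl⟩
      induction b using Finsupp.induction_linear with
      | zero => rw [map_zero, zero_mul]; exact Submodule.zero_mem _
      | add f g hf hg => rw [map_add, add_mul]; exact Submodule.add_mem _ hf hg
      | single i p =>
        induction b' using Finsupp.induction_linear with
        | zero => rw [map_zero, mul_zero]; exact Submodule.zero_mem _
        | add f g hf hg => rw [map_add, mul_add]; exact Submodule.add_mem _ hf hg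
        | single j q =>
          rw [recOp_single, recOp_single, recTerm_mul, ← recOp_single]
          exact LinearMap.mem_range_self _ _)

lemma recTerm_mem (j : ℤ) (p : ℝ[X]) : recTerm j p ∈ recAlg :=
  ⟨Finsupp.single j p, recOp_single j p⟩

/-- Operations in the variable commute with operations in the index. -/
lemma commute_termwise {B : ℝ → Module.End ℝ (ℤ → ℝ[X])} (hB : B ∈ recAlg) (ν : ℝ)
    (f : Module.End ℝ ℝ[X]) : Commute (B ν) (termwise f) := by
  obtain ⟨b, rfl⟩ := hB
  refine LinearMap.ext fun ψ => funext fun n => ?_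
  simp only [Module.End.mul_apply, termwise_apply, recOp_apply, Finsupp.sum, map_sum, map_smul]

lemma _root_.Commute.apply_comm {A B : Module.End ℝ (ℤ → ℝ[X])} (h : Commute A B)
    (ψ : ℤ → ℝ[X]) : A (B ψ) = B (A ψ) := LinearMap.congr_fun h.eq ψ

/-- The three-term operator of the Meixner polynomials, with `α = 1 / (1 - a)`,
`β = a / (1 - a)`. -/
noncomputable def jacobiOp (α β c : ℝ) : ℝ → Module.End ℝ (ℤ → ℝ[X]) :=
  recTerm 1 (X + 1) + recTerm 0 (C (α + β) * X + C (c * β)) +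
    recTerm (-1) (C (α * β) * (X - 1 + C c))

lemma jacobiOp_mem (α β c : ℝ) : jacobiOp α β c ∈ recAlg :=
  add_mem (add_mem (recTerm_mem _ _) (recTerm_mem _ _)) (recTerm_mem _ _)

/-- A sequence is of Meixner type, with twist `θ` and offset `ν`, if it satisfies the shift
relation and the three-term relation of the Meixner polynomials at the indices `n + ν`. The
Meixner polynomials have `θ = 1` and `ν = 0`; those with inverse first parameter, indexed
backwards, have `θ = 1 / a` and `ν = -c`. -/
structure IsMeixnerSeq (α β c θ ν : ℝ) (ψ : ℤ → ℝ[X]) : Prop where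
  shift_rel : ∀ n, twShift θ (ψ (n + 1)) + β • twShift θ (ψ n) = ψ (n + 1) + α • ψ n
  three_term : ∀ n, X * ψ n = jacobiOp α β c ν ψ n

section

variable {α β c θ ν : ℝ} {ψ : ℤ → ℝ[X]}

lemma IsMeixnerSeq.add_smul_termwise (h : IsMeixnerSeq α β c θ ν ψ) :
    (recTerm 1 1 ν + β • 1) (termwise (twShift θ) ψ) = (recTerm 1 1 ν + α • 1) ψ := by
  ext1 n
  have := h.shift_rel n
  simpa [recTerm, termwise_apply] using this

lemma IsMeixnerSeq.termwise_lmul (h : IsMeixnerSeq α β c θ ν ψ) (q : ℝ[X]) :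
    termwise (Algebra.lmul ℝ ℝ[X] q) ψ = aeval (jacobiOp α β c ν) q ψ := by
  have hX : termwise (Algebra.lmul ℝ ℝ[X] X) ψ = jacobiOp α β c ν ψ := by
    ext1 n
    exact h.three_term n
  have hpow : ∀ m : ℕ, termwise (Algebra.lmul ℝ ℝ[X] (X ^ m)) ψ =
      (jacobiOp α β c ν ^ m) ψ := by
    intro m
    induction m with
    | zero => rw [pow_zero, map_one, map_one, pow_zero]
    | succ m ih =>
      have hc : Commute (jacobiOp α β c ν ^ m) (termwise (Algebra.lmul ℝ ℝ[X] X)) :=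
        (commute_termwise (jacobiOp_mem α β c) ν _).pow_left m
      rw [pow_succ, mul_comm, map_mul, map_mul, Module.End.mul_apply, ih, ← hc.apply_comm, hX,
        pow_succ, Module.End.mul_apply]
  induction q using Polynomial.induction_on' with
  | add p q hp hq =>
    rw [map_add, map_add, map_add, LinearMap.add_apply, LinearMap.add_apply, hp, hq]
  | monomial m t =>
    rw [← smul_X_eq_monomial, map_smul, map_smul, map_smul, LinearMap.smul_apply,
      LinearMap.smul_apply, hpow, map_pow, aeval_X]

/-- The shift relation turns powers of the twisted shift into recurrence operators with constant
coefficients. -/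
lemma IsMeixnerSeq.pow_termwise_pow (h : IsMeixnerSeq α β c θ ν ψ) {K m : ℕ} (hm : m ≤ K) :
    ((recTerm 1 1 ν + β • 1) ^ K) ((termwise (twShift θ) ^ m) ψ) =
      ((recTerm 1 1 ν + β • 1) ^ (K - m) * (recTerm 1 1 ν + α • 1) ^ m) ψ := by
  set U := recTerm 1 1 ν + β • (1 : Module.End ℝ (ℤ → ℝ[X]))
  set V := recTerm 1 1 ν + α • (1 : Module.End ℝ (ℤ → ℝ[X]))
  set T := termwise (twShift θ)
  have hUT : Commute U T := (commute_termwise (recTerm_mem 1 1) ν _).add_left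
    ((Commute.one_left _).smul_left β)
  have hUV : Commute U V := by
    refine Commute.add_left (Commute.add_right (Commute.refl _) ?_) ((Commute.one_left _).smul_left β)
    exact (Commute.one_right _).smul_right α
  have hm' : (U ^ m) ((T ^ m) ψ) = (V ^ m) ψ := by
    clear hm
    induction m with
    | zero => rfl
    | succ m ih =>
      rw [← Module.End.mul_apply, pow_succ U, mul_assoc, pow_succ T, ← mul_assoc U,
        (hUT.pow_right m).eq, mul_assoc, Module.End.mul_apply, Module.End.mul_apply,
        Module.End.mul_apply, h.add_smul_termwise]
      have hVT : Commute V T := (commute_termwise (recTerm_mem 1 1) ν _).add_left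
        ((Commute.one_left _).smul_left α)
      rw [← Module.End.mul_apply, ← Module.End.mul_apply, mul_assoc, ← (hVT.pow_right m).eq,
        ← mul_assoc, (hUV.pow_left m).eq, mul_assoc, Module.End.mul_apply, Module.End.mul_apply,
        ih, pow_succ', Module.End.mul_apply]
  obtain ⟨i, rfl⟩ := Nat.exists_eq_add_of_le hm
  rw [Nat.add_sub_cancel_left, add_comm m, pow_add, Module.End.mul_apply, hm',
    Module.End.mul_apply]

/-- On sequences of Meixner type the symbol `(T - 1)(α - β T)` is invertible. -/
lemma IsMeixnerSeq.pow_termwise_aeval (h : IsMeixnerSeq α β c θ ν ψ) (hαβ : α - β = 1) (e : ℕ) :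
    ((recTerm 1 1 ν + β • 1) ^ (2 * e))
      (termwise (aeval (twShift θ) (((X - C 1) * (C α - C β * X)) ^ e)) ψ) =
      (recTerm 1 1 ν ^ e) ψ := by
  set L := recTerm 1 1 ν
  set U := L + β • (1 : Module.End ℝ (ℤ → ℝ[X])) with hU
  set T := termwise (twShift θ)
  have hLT : Commute L T := commute_termwise (recTerm_mem 1 1) ν _
  have hUT : Commute U T := hLT.add_left ((Commute.one_left _).smul_left β)
  have hUL : Commute U L := (Commute.refl L).add_left ((Commute.one_left _).smul_left β)
  have hE : termwise (aeval (twShift θ) (((X - C 1) * (C α - C β * X)) ^ e)) =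
      ((T - 1) * (α • 1 - β • T)) ^ e := by
    rw [map_pow, map_pow, map_mul, map_mul, map_sub, map_sub, map_sub, map_sub, map_mul, aeval_X,
      aeval_C, aeval_C, aeval_C, map_one, map_one, Algebra.algebraMap_eq_smul_one,
      Algebra.algebraMap_eq_smul_one, smul_mul_assoc, one_mul, map_smul, map_smul, map_one]
  have hUE : Commute U ((T - 1) * (α • 1 - β • T)) :=
    ((hUT.sub_right (Commute.one_right _))).mul_right
      (((Commute.one_right _).smul_right α).sub_right (hUT.smul_right β))
  have hLE : Commute L ((T - 1) * (α • 1 - β • T)) :=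
    ((hLT.sub_right (Commute.one_right _))).mul_right
      (((Commute.one_right _).smul_right α).sub_right (hLT.smul_right β))
  have h1 : U (T ψ) = U ψ + ψ := by
    have := h.add_smul_termwise
    rw [show (recTerm 1 1 ν + β • 1) = U from rfl] at this
    rw [this, hU, show α = β + 1 by linarith, add_smul, one_smul, ← add_assoc]
    rfl
  have hstep : (U ^ 2) (((T - 1) * (α • 1 - β • T)) ψ) = L ψ := by
    have hcomm : U ^ 2 * ((T - 1) * (α • 1 - β • T)) = (U * (α • 1 - β • T)) * (U * (T - 1)) := by
      have c1 : Commute (T - 1) (α • 1 - β • T) :=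
        ((Commute.one_right _).smul_right α).sub_right
          (((Commute.refl T).sub_left (Commute.one_left _)).smul_right β)
      have c2 : Commute U (α • 1 - β • T) :=
        ((Commute.one_right _).smul_right α).sub_right (hUT.smul_right β)
      rw [c1.eq, pow_two, mul_assoc, ← mul_assoc U (α • 1 - β • T), c2.eq]
      simp only [mul_assoc]
      rw [← mul_assoc U (α • 1 - β • T), c2.eq, mul_assoc]
    rw [← Module.End.mul_apply, hcomm, Module.End.mul_apply]
    have h2 : (U * (T - 1)) ψ = ψ := by
      rw [Module.End.mul_apply, LinearMap.sub_apply, map_sub, h1, Module.End.one_apply]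
      abel
    rw [h2, Module.End.mul_apply, LinearMap.sub_apply, LinearMap.smul_apply, LinearMap.smul_apply,
      Module.End.one_apply, map_sub, map_smul, map_smul, h1, hU, LinearMap.add_apply,
      LinearMap.smul_apply, Module.End.one_apply, show α = β + 1 by linarith]
    module
  rw [hE]
  clear hE
  induction e with
  | zero => rfl
  | succ e ih =>
    rw [Nat.mul_succ, pow_add, pow_succ _ e, ← Module.End.mul_apply, mul_assoc,
      ← mul_assoc (U ^ 2), ((hUE.pow_left 2).pow_right e).eq, mul_assoc, Module.End.mul_apply,
      Module.End.mul_apply, Module.End.mul_apply, hstep, ← Module.End.mul_apply,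
      ← Module.End.mul_apply, mul_assoc, ← (hLE.pow_right e).eq, ← mul_assoc,
      (hUL.pow_left (2 * e)).eq, mul_assoc, Module.End.mul_apply, Module.End.mul_apply, ih,
      pow_succ', Module.End.mul_apply]

end

/-- Under the hypotheses of the intertwining relation, one recurrence relation with polynomial
coefficients holds for the images of all sequences of Meixner type. -/
theorem exists_recurrence {k : ℕ} (ρ : Fin k → ℝ) (φ : Fin k → ℝ[X]) (lam : ℝ[X])
    (κ : ℝ) (hlam : taylor 1 lam - lam = C κ * taylor 1
      (Matrix.of fun i l : Fin k => (twShift (ρ i) ^ (l : ℕ)) (φ i)).det)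
    (d : Fin (k + 1) → ℝ[X]) (hd : ∀ i, diffOp d (ρ i) (φ i) = 0) (hd0 : d (Fin.last k) ≠ 0)
    (α β c : ℝ) (hαβ : α - β = 1) (hρ : ∀ i, ρ i = 1 ∨ α = β * ρ i) :
    ∃ b : ℤ →₀ ℝ[X], ∀ (θ ν : ℝ) (ψ : ℤ → ℝ[X]), IsMeixnerSeq α β c θ ν ψ → ∀ n,
      lam * diffOp d θ (ψ n) =
        b.sum fun j p => p.eval ((n : ℝ) + ν) • diffOp d θ (ψ (n + j)) := by
  obtain ⟨e, he⟩ := exists_intertwiner ρ φ lam κ hlam d hd hd0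
  set E : ℝ[X] := ((X - C 1) * (C α - C β * X)) ^ e with hE
  have hdvd : ∀ i, (X - C (ρ i)) ^ e ∣ E := by
    intro i
    refine pow_dvd_pow_of_dvd ?_ e
    rcases hρ i with h | h
    · rw [h]; exact dvd_mul_right _ _
    · refine Dvd.dvd.mul_left ⟨-C β, ?_⟩ _
      rw [h, C_mul]; ring
  have hEdeg : E.natDegree ≤ 2 * e := by
    refine natDegree_pow_le.trans ?_
    rw [mul_comm]
    refine Nat.mul_le_mul_right _ (natDegree_mul_le_of_le (m := 1) (n := 1) ?_ ?_)
    · rw [natDegree_X_sub_C]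
    · refine (natDegree_sub_le _ _).trans (max_le (by simp) ?_)
      exact (natDegree_C_mul_le _ _).trans natDegree_X_le
  obtain ⟨r, hrdeg, hr⟩ := he e le_rfl E hdvd
  set U : ℝ → Module.End ℝ (ℤ → ℝ[X]) := recTerm 1 1 + β • 1 with hU
  set V : ℝ → Module.End ℝ (ℤ → ℝ[X]) := recTerm 1 1 + α • 1 with hV
  set B₀ : ℝ → Module.End ℝ (ℤ → ℝ[X]) := ∑ m ∈ Finset.range (2 * e + 1),
    U ^ (2 * e - m) * V ^ m * aeval (jacobiOp α β c) (r.coeff m) with hB₀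
  have hUm : U ∈ recAlg := add_mem (recTerm_mem _ _) (recAlg.smul_mem (one_mem _) β)
  have hVm : V ∈ recAlg := add_mem (recTerm_mem _ _) (recAlg.smul_mem (one_mem _) α)
  have hJm : ∀ q : ℝ[X], aeval (jacobiOp α β c) q ∈ recAlg := fun q =>
    Algebra.adjoin_le (Set.singleton_subset_iff.mpr (jacobiOp_mem α β c))
      (aeval_mem_adjoin_singleton ℝ _)
  have hterm : ∀ m, U ^ (2 * e - m) * V ^ m * aeval (jacobiOp α β c) (r.coeff m) ∈ recAlg :=
    fun m => mul_mem (mul_mem (pow_mem hUm _) (pow_mem hVm _)) (hJm _)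
  have hBm : recTerm (-1) 1 ^ e * B₀ ∈ recAlg :=
    mul_mem (pow_mem (recTerm_mem _ _) _) (sum_mem fun m _ => hterm m)
  obtain ⟨b, hb⟩ := hBm
  refine ⟨b, fun θ ν ψ hψ => ?_⟩
  have hJν : ∀ q : ℝ[X], (aeval (jacobiOp α β c) q) ν = aeval (jacobiOp α β c ν) q := fun q =>
    (aeval_algHom_apply (Pi.evalAlgHom ℝ (fun _ : ℝ => Module.End ℝ (ℤ → ℝ[X])) ν) _ q).symm
  set D := termwise (diffOp d θ)
  have hkey : (termwise (Algebra.lmul ℝ ℝ[X] lam)) ((recTerm 1 1 ν ^ e) (D ψ)) = B₀ ν (D ψ) := by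
    have h1 := congrArg (fun f => (U ν ^ (2 * e)) (termwise f ψ)) (hr θ)
    simp only [map_mul, Module.End.mul_apply] at h1
    have hcU : ∀ f, Commute (U ν ^ (2 * e)) (termwise f) := fun f =>
      (commute_termwise hUm ν f).pow_left _
    have hsymb : symbolOp θ r = ∑ m ∈ Finset.range (2 * e + 1),
        Algebra.lmul ℝ ℝ[X] (r.coeff m) * twShift θ ^ m :=
      eval₂_eq_sum_range' _ (Nat.lt_succ_of_le (hrdeg.trans hEdeg)) _
    have hleft : (U ν ^ (2 * e)) (D (termwise (symbolOp θ r) ψ)) = B₀ ν (D ψ) := by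
      rw [hsymb, map_sum, LinearMap.sum_apply, map_sum, map_sum, hB₀, Finset.sum_apply,
        LinearMap.sum_apply]
      refine Finset.sum_congr rfl fun m hm => ?_
      have hm' : m ≤ 2 * e := Nat.lt_succ_iff.mp (Finset.mem_range.mp hm)
      have hUV := hψ.pow_termwise_pow hm'
      have hcW : Commute (U ν ^ (2 * e - m) * V ν ^ m) (termwise (Algebra.lmul ℝ ℝ[X] (r.coeff m)))
        := ((commute_termwise hUm ν _).pow_left _).mul_left ((commute_termwise hVm ν _).pow_left _)
      have hcD := commute_termwise (hterm m) ν (diffOp d θ)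
      rw [hcD.apply_comm, Pi.mul_apply, Pi.mul_apply, Pi.pow_apply, Pi.pow_apply, hJν,
        Module.End.mul_apply, ← hψ.termwise_lmul, hcW.apply_comm, (hcU _).apply_comm, map_mul,
        Module.End.mul_apply, (hcU _).apply_comm, map_pow]
      exact congrArg (fun χ => D (termwise (Algebra.lmul ℝ ℝ[X] (r.coeff m)) χ)) hUV
    have hright := hψ.pow_termwise_aeval hαβ e
    rw [hleft, (hcU _).apply_comm, (hcU _).apply_comm] at h1
    have hcL : Commute (recTerm 1 1 ν ^ e) D := (commute_termwise (recTerm_mem 1 1) ν _).pow_left _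
    rw [h1, hcL.apply_comm]
    exact congrArg (fun χ => termwise (Algebra.lmul ℝ ℝ[X] lam) (D χ)) hright.symm
  intro n
  have hmul : recTerm (-1) 1 ν * recTerm 1 1 ν = 1 := by
    refine LinearMap.ext fun ψ => funext fun n => ?_
    simp [recTerm]
  have hmul' : recTerm 1 1 ν * recTerm (-1) 1 ν = 1 := by
    refine LinearMap.ext fun ψ => funext fun n => ?_
    simp [recTerm]
  have hLe : recTerm (-1) 1 ν ^ e * recTerm 1 1 ν ^ e = 1 := by
    rw [← Commute.mul_pow (hmul.trans hmul'.symm), hmul, one_pow]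
  have hcI : Commute (recTerm (-1) 1 ν ^ e) (termwise (Algebra.lmul ℝ ℝ[X] lam)) :=
    (commute_termwise (recTerm_mem (-1) 1) ν _).pow_left _
  have hfinal : recOp b ν (D ψ) = termwise (Algebra.lmul ℝ ℝ[X] lam) (D ψ) := by
    rw [hb, Pi.mul_apply, Pi.pow_apply, Module.End.mul_apply, ← hkey, hcI.apply_comm,
      ← Module.End.mul_apply (recTerm (-1) 1 ν ^ e), hLe, Module.End.one_apply]
  have := congrFun hfinal n
  rw [recOp_apply] at this
  exact this.symm

/-! ### The order of the recurrence -/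

/-- If the degrees of the `χ_n` grow by `1`, the top coefficient of `∑_j b_j(n + ν) χ_{n + j}`
comes from the largest index `J`. -/
lemma exists_coeff_sum (χ : ℤ → ℝ[X]) (n₀ δ : ℤ)
    (hχ : ∀ n ≥ n₀, χ n ≠ 0 ∧ ((χ n).natDegree : ℤ) = n + δ) (b : ℤ →₀ ℝ[X]) (ν : ℝ) (J : ℤ)
    (hb : ∀ j, J < j → b j = 0) :
    ∃ N : ℤ, ∀ n ≥ N, n₀ ≤ n ∧ χ (n + J) ≠ 0 ∧ ((χ (n + J)).natDegree : ℤ) = n + J + δ ∧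
      (b.sum fun j p => p.eval ((n : ℝ) + ν) • χ (n + j)).coeff (χ (n + J)).natDegree =
        (b J).eval ((n : ℝ) + ν) * (χ (n + J)).leadingCoeff := by
  refine ⟨n₀ + |J| + ∑ j ∈ b.support, |j|, fun n hn => ?_⟩
  have hpos : 0 ≤ ∑ j ∈ b.support, |j| := Finset.sum_nonneg fun _ _ => abs_nonneg _
  have hJ := neg_abs_le J
  have hJ' := abs_nonneg J
  obtain ⟨h1, h2⟩ := hχ (n + J) (by linarith)
  refine ⟨by linarith, h1, h2, ?_⟩
  rw [Finsupp.sum, finsetSum_coeff, Finset.sum_eq_single J]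
  · rw [coeff_smul, smul_eq_mul]; rfl
  · intro j hj hne
    have hjle : j < J := by
      rcases lt_trichotomy j J with h | h | h
      · exact h
      · exact absurd h hne
      · exact absurd (hb j h) (Finsupp.mem_support_iff.mp hj)
    have h3 : |j| ≤ ∑ j ∈ b.support, |j| :=
      Finset.single_le_sum (f := fun j => |j|) (fun _ _ => abs_nonneg _) hj
    have h4 := neg_abs_le j
    have h5 := (hχ (n + j) (by linarith)).2
    rw [coeff_smul, coeff_eq_zero_of_natDegree_lt (by omega), smul_zero]
  · intro hJ
    rw [Finsupp.notMem_support_iff.mp hJ]; simp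

/-- Comparison of degrees bounds the order of a recurrence relation with eigenvalue `λ`. -/
lemma eq_zero_of_natDegree_lt (χ : ℤ → ℝ[X]) (n₀ δ : ℤ)
    (hχ : ∀ n ≥ n₀, χ n ≠ 0 ∧ ((χ n).natDegree : ℤ) = n + δ) (b : ℤ →₀ ℝ[X]) (ν : ℝ)
    (lam : ℝ[X]) (h : ∀ n, lam * χ n = b.sum fun j p => p.eval ((n : ℝ) + ν) • χ (n + j))
    (j : ℤ) (hj : (lam.natDegree : ℤ) < j) : b j = 0 := by
  by_contra hne
  have hjs : j ∈ b.support := Finsupp.mem_support_iff.mpr hne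
  set J := b.support.max' ⟨j, hjs⟩ with hJ
  have hJs : b J ≠ 0 := Finsupp.mem_support_iff.mp (b.support.max'_mem _)
  have hjJ : j ≤ J := b.support.le_max' _ hjs
  obtain ⟨N, hN⟩ := exists_coeff_sum χ n₀ δ hχ b ν J fun i hi => by
    by_contra hi0
    exact absurd (b.support.le_max' _ (Finsupp.mem_support_iff.mpr hi0)) (not_le.mpr hi)
  apply hJs
  refine Polynomial.eq_zero_of_infinite_isRoot _ (Set.Infinite.mono (s :=
    (fun n : ℤ => (n : ℝ) + ν) '' Set.Ici N) ?_ ?_)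
  · rintro _ ⟨n, hn, rfl⟩
    obtain ⟨h0, h1, h2, h3⟩ := hN n hn
    rw [← h n, coeff_eq_zero_of_natDegree_lt] at h3
    · exact (mul_eq_zero.mp h3.symm).resolve_right (leadingCoeff_ne_zero.mpr h1)
    · refine lt_of_le_of_lt natDegree_mul_le ?_
      have := (hχ n h0).2
      omega
  · exact (Set.Ici_infinite N).image fun x _ y _ hxy => by simpa using hxy

lemma exists_eval_ne_zero (χ : ℤ → ℝ[X]) (n₀ δ : ℤ)
    (hχ : ∀ n ≥ n₀, χ n ≠ 0 ∧ ((χ n).natDegree : ℤ) = n + δ) (b : ℤ →₀ ℝ[X]) (ν : ℝ)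
    (lam : ℝ[X]) (hlam : lam ≠ 0)
    (h : ∀ n, lam * χ n = b.sum fun j p => p.eval ((n : ℝ) + ν) • χ (n + j)) :
    ∃ N : ℤ, ∀ n ≥ N, (b lam.natDegree).eval ((n : ℝ) + ν) ≠ 0 := by
  obtain ⟨N, hN⟩ := exists_coeff_sum χ n₀ δ hχ b ν lam.natDegree
    fun j hj => eq_zero_of_natDegree_lt χ n₀ δ hχ b ν lam h j hj
  refine ⟨N, fun n hn h0 => ?_⟩
  obtain ⟨h1, h2, h3, h4⟩ := hN n hn
  have h5 := (hχ n h1).1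
  have h6 : (lam * χ n).natDegree = (χ (n + lam.natDegree)).natDegree := by
    rw [natDegree_mul hlam h5]
    have := (hχ n h1).2
    omega
  rw [← h n, h0, zero_mul, ← h6] at h4
  exact leadingCoeff_ne_zero.mpr (mul_ne_zero hlam h5) h4

/-! ### The Casoratian operator -/

/-- The cofactors of the first row in the Casoratian of one further function and the `φ i`. -/
noncomputable def cofactors {k : ℕ} (ρ : Fin k → ℝ) (φ : Fin k → ℝ[X]) : Fin (k + 1) → ℝ[X] :=
  fun l => (-1) ^ (l : ℕ) *
    (Matrix.of fun i j : Fin k => (twShift (ρ i) ^ (l.succAbove j : ℕ)) (φ i)).det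

lemma diffOp_cofactors {k : ℕ} (ρ : Fin k → ℝ) (φ : Fin k → ℝ[X]) (θ : ℝ) (p : ℝ[X]) :
    diffOp (cofactors ρ φ) θ p = (Matrix.of fun s t : Fin (k + 1) =>
      (twShift ((Fin.cons θ ρ : Fin (k + 1) → ℝ) s) ^ (t : ℕ))
        ((Fin.cons p φ : Fin (k + 1) → ℝ[X]) s)).det := by
  rw [Matrix.det_succ_row_zero, diffOp, LinearMap.sum_apply]
  refine Finset.sum_congr rfl fun l _ => ?_
  rw [Module.End.mul_apply, lmul_apply_apply, cofactors, mul_right_comm]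
  rfl

lemma diffOp_cofactors_self {k : ℕ} (ρ : Fin k → ℝ) (φ : Fin k → ℝ[X]) (i : Fin k) :
    diffOp (cofactors ρ φ) (ρ i) (φ i) = 0 := by
  rw [diffOp_cofactors]
  refine Matrix.det_zero_of_row_eq (Fin.succ_ne_zero i).symm ?_
  ext1 t
  simp

lemma cofactors_last {k : ℕ} (ρ : Fin k → ℝ) (φ : Fin k → ℝ[X]) :
    cofactors ρ φ (Fin.last k) = (-1) ^ k *
      (Matrix.of fun i j : Fin k => (twShift (ρ i) ^ (j : ℕ)) (φ i)).det := by
  simp [cofactors]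

/-- The coefficients of the operator that carries `m_{n - u_F}` to the exceptional polynomial. -/
noncomputable def exceptionalCoeff (a c : ℝ) (F₁ F₂ : Finset ℕ) :
    Fin (F₁.card + F₂.card + 1) → ℝ[X] :=
  cofactors (rowTwist a F₁ F₂) (rowPoly a c F₁ F₂)

lemma exceptional_eq (a c : ℝ) (F₁ F₂ : Finset ℕ) (n : ℤ) :
    exceptional a c F₁ F₂ n =
      diffOp (exceptionalCoeff a c F₁ F₂) 1 (meixner a c (n - u F₁ F₂)) := by
  rw [exceptionalCoeff, diffOp_cofactors, exceptional]
  congr 1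
  ext1 s t
  refine Fin.cases ?_ (fun i => ?_) s
  · simp [twShift_pow_apply]
  · simp [rows_eq]

/-- Degree growth under the Casoratian operator, for both twists. -/
lemma natDegree_diffOp_exceptionalCoeff (a c : ℝ) (ha0 : a ≠ 0) (ha1 : a ≠ 1) (F₁ F₂ : Finset ℕ)
    (θ : ℝ) (k₁ k₂ : ℕ) (hθ : θ = 1 ∧ k₁ = F₁.card + 1 ∧ k₂ = F₂.card ∨
      θ = a⁻¹ ∧ k₁ = F₁.card ∧ k₂ = F₂.card + 1) (p : ℝ[X]) (hp : p ≠ 0)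
    (hp₁ : ∀ f ∈ F₁, f < p.natDegree) (hp₂ : ∀ f ∈ F₂, f < p.natDegree) :
    diffOp (exceptionalCoeff a c F₁ F₂) θ p ≠ 0 ∧
      (diffOp (exceptionalCoeff a c F₁ F₂) θ p).natDegree + k₁.choose 2 + k₂.choose 2 =
        p.natDegree + (∑ f ∈ F₁, f + ∑ f ∈ F₂, f) := by
  have hb1 := inv_ne_one_of_ne_one ha1
  have hdeg := natDegree_rowPoly a c ha0 ha1 F₁ F₂
  have hlt : ∀ i, (rowPoly a c F₁ F₂ i).natDegree < p.natDegree := by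
    intro i
    rw [(hdeg i).2]
    refine Fin.addCases (fun i => ?_) (fun i => ?_) i
    · simpa using hp₁ _ (elt_mem F₁ i)
    · simpa using hp₂ _ (elt_mem F₂ i)
  have hρ : ∀ s, (Fin.cons θ (rowTwist a F₁ F₂) : Fin (F₁.card + F₂.card + 1) → ℝ) s = 1 ∨
      (Fin.cons θ (rowTwist a F₁ F₂) : Fin (F₁.card + F₂.card + 1) → ℝ) s = a⁻¹ := by
    intro s
    refine Fin.cases ?_ (fun i => ?_) s
    · rw [Fin.cons_zero]
      exact hθ.imp And.left And.left
    · rw [Fin.cons_succ]; exact rowTwist_eq a F₁ F₂ i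
  have hφ : ∀ s, (Fin.cons p (rowPoly a c F₁ F₂) : Fin (F₁.card + F₂.card + 1) → ℝ[X]) s ≠ 0 := by
    intro s
    refine Fin.cases ?_ (fun i => ?_) s
    · rwa [Fin.cons_zero]
    · rw [Fin.cons_succ]; exact (hdeg i).1
  have hinj : ∀ s t, (Fin.cons θ (rowTwist a F₁ F₂) : Fin (F₁.card + F₂.card + 1) → ℝ) s =
      (Fin.cons θ (rowTwist a F₁ F₂) : Fin (F₁.card + F₂.card + 1) → ℝ) t →
      ((Fin.cons p (rowPoly a c F₁ F₂) : Fin (F₁.card + F₂.card + 1) → ℝ[X]) s).natDegree =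
      ((Fin.cons p (rowPoly a c F₁ F₂) : Fin (F₁.card + F₂.card + 1) → ℝ[X]) t).natDegree →
      s = t := by
    intro s t
    refine Fin.cases ?_ (fun i => ?_) s <;> refine Fin.cases ?_ (fun j => ?_) t <;>
      simp only [Fin.cons_zero, Fin.cons_succ] <;> intro h h'
    · trivial
    · exact absurd h' (hlt j).ne'
    · exact absurd h' (hlt i).ne
    · rw [(hdeg i).2, (hdeg j).2] at h'
      rw [rowTwist_elt_injective ha1 F₁ F₂ i j h h']
  have hk₁ : ∑ s, (if (Fin.cons θ (rowTwist a F₁ F₂) : Fin (F₁.card + F₂.card + 1) → ℝ) s = 1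
      then 1 else 0) = k₁ := by
    rw [Fin.sum_univ_succ]
    simp only [Fin.cons_zero, Fin.cons_succ, sum_rowTwist ha1]
    rcases hθ with ⟨h, h', -⟩ | ⟨h, h', -⟩
    · rw [if_pos h, h', add_comm]
    · rw [if_neg (h ▸ hb1), h', zero_add]
  obtain ⟨h1, h2⟩ := casoratian_ne_zero_and_natDegree a⁻¹ (inv_ne_zero ha0) hb1 (k₁ := k₁)
    (k₂ := k₂) (Equiv.refl (Fin (F₁.card + F₂.card + 1))) _ _ hρ hφ hinj hk₁ (by omega)
  rw [exceptionalCoeff, diffOp_cofactors]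
  refine ⟨h1, h2.trans ?_⟩
  rw [Fin.sum_univ_succ]
  simp only [Fin.cons_zero, Fin.cons_succ, (hdeg _).2]
  rw [Fin.sum_univ_add]
  simp only [Fin.append_left, Fin.append_right]
  rw [sum_elt F₁ (fun f => f), sum_elt F₂ (fun f => f)]

/-! ### The two sequences of Meixner type -/

lemma jacobiOp_apply (α β c ν : ℝ) (ψ : ℤ → ℝ[X]) (n : ℤ) :
    jacobiOp α β c ν ψ n = C ((n : ℝ) + ν + 1) * ψ (n + 1) +
      C ((α + β) * ((n : ℝ) + ν) + c * β) * ψ n +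
      C (α * β * ((n : ℝ) + ν - 1 + c)) * ψ (n - 1) := by
  simp only [jacobiOp, recTerm, Pi.add_apply, LinearMap.add_apply, LinearMap.coe_mk,
    AddHom.coe_mk, smul_eq_C_mul, eval_add, eval_mul, eval_sub, eval_X, eval_C, eval_one, add_zero]
  rw [← sub_eq_add_neg n]

lemma isMeixnerSeq_meixner (a c : ℝ) (ha0 : a ≠ 0) (ha1 : a ≠ 1) :
    IsMeixnerSeq (1 - a)⁻¹ (a / (1 - a)) c 1 0 (meixner a c) where
  shift_rel n := by
    have h := meixner_shift a c ha0 (n + 1)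
    rw [add_sub_cancel_right] at h
    rw [twShift_apply, twShift_apply, C_1, one_mul, one_mul, smul_eq_C_mul, smul_eq_C_mul, h]
  three_term n := by
    rw [jacobiOp_apply, X_mul_meixner a c ha0 ha1 n]
    simp only [add_zero]

/-- The expansion of the generating function at `z = ∞`. -/
noncomputable def meixnerAtInfinity (a c : ℝ) (n : ℤ) : ℝ[X] :=
  C ((-((1 - a)⁻¹ * (a / (1 - a)))) ^ n) * meixner (1 / a) c (-n)

lemma isMeixnerSeq_meixnerAtInfinity (a c : ℝ) (ha0 : a ≠ 0) (ha1 : a ≠ 1) :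
    IsMeixnerSeq (1 - a)⁻¹ (a / (1 - a)) c a⁻¹ (-c) (meixnerAtInfinity a c) := by
  obtain ⟨hb0, hb1⟩ := one_div_ne_zero_and_ne_one ha0 ha1
  have hs : 1 - a ≠ 0 := sub_ne_zero.mpr ha1.symm
  have hα : (1 - a)⁻¹ ≠ 0 := inv_ne_zero hs
  have hβ : a / (1 - a) ≠ 0 := div_ne_zero ha0 hs
  have e1 := inv_one_sub_inv ha0 ha1
  have e2 := inv_div_one_sub_inv ha0 ha1
  have e3 : a / (1 - a) * a⁻¹ = (1 - a)⁻¹ := by field_simp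
  have hm1 := fun n : ℤ => meixner_shift (1 / a) c hb0 (-n)
  have hm2 := fun n : ℤ => X_mul_meixner (1 / a) c hb0 hb1 (-n)
  simp only [e1, e2] at hm1 hm2
  set α := (1 - a)⁻¹
  set β := a / (1 - a)
  have hz : -(α * β) ≠ 0 := neg_ne_zero.mpr (mul_ne_zero hα hβ)
  constructor
  · intro n
    have h := hm1 n
    simp only [meixnerAtInfinity, twShift_apply, smul_eq_C_mul, mul_comp, C_comp]
    rw [show -(n + 1) = -n - 1 by ring, zpow_add_one₀ hz]
    have e3' := congrArg (C : ℝ → ℝ[X]) e3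
    simp only [C_mul, C_neg] at h e3' ⊢
    linear_combination (C ((-(α * β)) ^ n) * C α) * h + C ((-(α * β)) ^ n) *
      ((meixner (1 / a) c (-n)).comp (X + 1) -
        C α * (meixner (1 / a) c (-n - 1)).comp (X + 1)) * e3'
  · intro n
    have h := hm2 n
    rw [jacobiOp_apply]
    simp only [meixnerAtInfinity]
    rw [show -(n + 1) = -n - 1 by ring, show -(n - 1) = -n + 1 by ring, zpow_add_one₀ hz]
    have hz1 : (-(α * β)) ^ n = (-(α * β)) ^ (n - 1) * -(α * β) := by
      rw [← zpow_add_one₀ hz, sub_add_cancel]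
    have hz2 := congrArg (C : ℝ → ℝ[X]) hz1
    push_cast at h
    simp only [C_mul, C_neg, C_add, C_sub, C_1] at h hz2 ⊢
    linear_combination C ((-(α * β)) ^ n) * h +
      (1 - C (n : ℝ)) * meixner (1 / a) c (-n + 1) * hz2

/-! ### Antidifferences -/

lemma exists_taylor_sub_eq (N : ℕ) : ∀ q : ℝ[X], q.degree < N →
    ∃ lam : ℝ[X], taylor 1 lam - lam = q := by
  have e : ∀ lam : ℝ[X], taylor 1 lam - lam = twShift 1 lam - (1 : ℝ) • lam := fun lam => by
    simp [twShift]
  induction N with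
  | zero =>
    intro q hq
    exact ⟨0, by rw [degree_eq_bot.mp (Nat.WithBot.lt_zero_iff.mp hq)]; simp⟩
  | succ N ih =>
    intro q hq
    have hN : (N : ℝ) + 1 ≠ 0 := by positivity
    set p : ℝ[X] := C (q.coeff N / (N + 1)) * X ^ (N + 1) with hp
    obtain ⟨h1, h2⟩ := natDegree_twShift_sub_le 1 p N (natDegree_C_mul_X_pow_le _ _)
    rw [← e] at h1 h2
    obtain ⟨lam, hlam⟩ := ih (q - (taylor 1 p - p)) (by
      rw [degree_lt_iff_coeff_zero]
      intro m hm
      rw [coeff_sub]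
      rcases hm.eq_or_lt with h | h
      · rw [← h, h2, hp, coeff_C_mul_X_pow, if_pos rfl, one_mul, mul_div_cancel₀ _ hN, sub_self]
      · rw [coeff_eq_zero_of_natDegree_lt (lt_of_le_of_lt h1 h),
          (degree_lt_iff_coeff_zero q (N + 1)).mp hq m h, sub_zero])
    exact ⟨lam + p, by rw [map_add]; linear_combination hlam⟩

lemma taylor_one_comp_X_sub_one (p : ℝ[X]) : (taylor 1 p).comp (X - 1) = p := by
  rw [taylor_apply, comp_assoc]; simp

lemma taylor_one_comp (p : ℝ[X]) : taylor 1 (p.comp (X - 1)) = p := by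
  rw [taylor_apply, comp_assoc]; simp

/-- Every polynomial is a backward difference. -/
lemma exists_sub_comp_eq (q : ℝ[X]) : ∃ lam : ℝ[X], lam - lam.comp (X - 1) = q := by
  obtain ⟨lam, h⟩ := exists_taylor_sub_eq ((taylor 1 q).natDegree + 1) (taylor 1 q)
    (lt_of_le_of_lt degree_le_natDegree (by exact_mod_cast Nat.lt_succ_self _))
  refine ⟨lam, ?_⟩
  have := congrArg (fun p => p.comp (X - 1)) h
  simpa only [sub_comp, taylor_one_comp_X_sub_one] using this

/-- The difference of a polynomial has degree one less. -/
lemma natDegree_of_taylor_sub_eq {lam q : ℝ[X]} (h : taylor 1 lam - lam = q) (hq : q ≠ 0) :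
    lam.natDegree = q.natDegree + 1 := by
  have e : taylor 1 lam - lam = twShift 1 lam - (1 : ℝ) • lam := by simp [twShift]
  rcases hd : lam.natDegree with _ | d
  · rw [e, twShift_of_natDegree_zero 1 lam hd.le] at h
    exact absurd h.symm hq
  · obtain ⟨h1, h2⟩ := natDegree_twShift_sub_le 1 lam d hd.le
    rw [← e, h] at h1 h2
    have h3 : lam.coeff (d + 1) ≠ 0 := by
      rw [← hd, coeff_natDegree, leadingCoeff_ne_zero]
      rintro rfl
      simp at hd
    rw [natDegree_eq_of_le_of_coeff_ne_zero h1]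
    rw [h2]
    exact mul_ne_zero (mul_ne_zero one_ne_zero (by positivity)) h3

end ExceptionalMeixner

open ExceptionalMeixner in
theorem corollary3 (a c : ℝ) (ha0 : a ≠ 0) (ha1 : a ≠ 1) (hc : ∀ k : ℕ, c ≠ -(k : ℝ))
    (F₁ F₂ : Finset ℕ) (hF₁ : ∀ f ∈ F₁, 0 < f) (hF₂ : ∀ f ∈ F₂, 0 < f)
    (hF : F₁.Nonempty ∨ F₂.Nonempty) :
    (∃ lam : ℝ[X], ExceptionalMeixner.IsLambda a c F₁ F₂ lam) ∧
    ∀ lam : ℝ[X], ExceptionalMeixner.IsLambda a c F₁ F₂ lam →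
      (lam.natDegree : ℤ) = ExceptionalMeixner.w F₁ F₂ ∧
      ∃ A : ℤ → ℕ → ℝ,
        (∀ j ∈ Finset.Icc (-ExceptionalMeixner.w F₁ F₂) (ExceptionalMeixner.w F₁ F₂),
          ∃ P Q : ℝ[X], ∀ n : ℕ,
            Q.eval (n : ℝ) ≠ 0 ∧ A j n = P.eval (n : ℝ) / Q.eval (n : ℝ)) ∧
        (∀ n : ℕ,
          ∑ j ∈ Finset.Icc (-ExceptionalMeixner.w F₁ F₂) (ExceptionalMeixner.w F₁ F₂),
            C (A j n) * ExceptionalMeixner.exceptional a c F₁ F₂ ((n : ℤ) + j) =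
          lam * ExceptionalMeixner.exceptional a c F₁ F₂ (n : ℤ)) ∧
        ∀ᶠ n : ℕ in Filter.atTop, A (ExceptionalMeixner.w F₁ F₂) n ≠ 0 := by
  refine ⟨exists_sub_comp_eq _, fun lam hlam => ?_⟩
  obtain ⟨κ, hκ, hinv⟩ := exists_casoratian_invol a c ha0 ha1 F₁ F₂
  obtain ⟨hΩ, hΩdeg⟩ := natDegree_casoratian a c ha0 ha1 F₁ F₂
  rw [IsLambda, hinv] at hlam
  have hΔ : taylor 1 lam - lam = C κ * taylor 1 (casoratian a c F₁ F₂) := by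
    have h := congrArg (taylor 1) hlam
    rwa [map_sub, taylor_one_comp, taylor_mul, taylor_one_C] at h
  have hw : (lam.natDegree : ℤ) = w F₁ F₂ := by
    have h := natDegree_of_taylor_sub_eq hΔ (mul_ne_zero (C_ne_zero.mpr hκ)
      fun h => hΩ (taylor_injective 1 (h.trans (map_zero _).symm)))
    rw [natDegree_C_mul hκ, natDegree_taylor] at h
    rw [w, h]
    have := congrArg (Nat.cast (R := ℤ)) hΩdeg
    push_cast at this ⊢
    linarith
  refine ⟨hw, ?_⟩
  have hd0 : exceptionalCoeff a c F₁ F₂ (Fin.last _) ≠ 0 := by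
    rw [exceptionalCoeff, cofactors_last, ← casoratian_eq]
    exact mul_ne_zero (pow_ne_zero _ (neg_ne_zero.mpr one_ne_zero)) hΩ
  have hs : 1 - a ≠ 0 := sub_ne_zero.mpr ha1.symm
  have hρ : ∀ i, rowTwist a F₁ F₂ i = 1 ∨ (1 - a)⁻¹ = a / (1 - a) * rowTwist a F₁ F₂ i := by
    intro i
    refine (rowTwist_eq a F₁ F₂ i).imp_right fun h => ?_
    rw [h]
    field_simp
  rw [casoratian_eq] at hΔ
  obtain ⟨b, hb⟩ := exists_recurrence (rowTwist a F₁ F₂) (rowPoly a c F₁ F₂) lam κ hΔ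
    (exceptionalCoeff a c F₁ F₂) (diffOp_cofactors_self _ _) hd0 (1 - a)⁻¹ (a / (1 - a)) c
    (inv_sub_div ha1) hρ
  obtain ⟨hd0', hd1'⟩ := one_div_ne_zero_and_ne_one ha0 ha1
  set D := diffOp (exceptionalCoeff a c F₁ F₂) with hD
  set s : ℕ := ∑ f ∈ F₁, f + ∑ f ∈ F₂, f with hsum
  have hle : ∀ f ∈ F₁ ∪ F₂, f ≤ ∑ f ∈ F₁ ∪ F₂, f := fun f hf =>
    Finset.single_le_sum (f := fun f => f) (fun _ _ => Nat.zero_le _) hf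
  set n₀ : ℕ := ∑ f ∈ F₁ ∪ F₂, f + 1
  -- The degrees grow by one along each of the two sequences.
  have hχ : ∀ n ≥ (n₀ : ℤ), D 1 (meixner a c n) ≠ 0 ∧ ((D 1 (meixner a c n)).natDegree : ℤ) =
      n + (s - (F₁.card + 1).choose 2 - F₂.card.choose 2) := by
    intro n hn
    lift n to ℕ using by omega
    have hn' : n₀ ≤ n := by exact_mod_cast hn
    have hdeg := natDegree_meixner a c ha0 ha1 n
    obtain ⟨h1, h2⟩ := natDegree_diffOp_exceptionalCoeff a c ha0 ha1 F₁ F₂ 1 _ _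
      (Or.inl ⟨rfl, rfl, rfl⟩) (meixner a c n) (meixner_ne_zero a c ha0 ha1 n)
      (fun f hf => by have := hle f (Finset.mem_union_left _ hf); omega)
      (fun f hf => by have := hle f (Finset.mem_union_right _ hf); omega)
    rw [hdeg] at h2
    refine ⟨h1, ?_⟩
    have := congrArg (Nat.cast (R := ℤ)) h2
    push_cast at this ⊢
    linarith
  have hz : (-((1 - a)⁻¹ * (a / (1 - a)))) ≠ 0 :=
    neg_ne_zero.mpr (mul_ne_zero (inv_ne_zero hs) (div_ne_zero ha0 hs))
  have hχ' : ∀ n ≥ (n₀ : ℤ), D a⁻¹ (meixnerAtInfinity a c (-n)) ≠ 0 ∧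
      ((D a⁻¹ (meixnerAtInfinity a c (-n))).natDegree : ℤ) =
      n + (s - F₁.card.choose 2 - (F₂.card + 1).choose 2) := by
    intro n hn
    lift n to ℕ using by omega
    have hn' : n₀ ≤ n := by exact_mod_cast hn
    have hne : meixnerAtInfinity a c (-n) ≠ 0 := by
      rw [meixnerAtInfinity, neg_neg]
      exact mul_ne_zero (C_ne_zero.mpr (zpow_ne_zero _ hz)) (meixner_ne_zero _ c hd0' hd1' n)
    have hdeg : (meixnerAtInfinity a c (-n)).natDegree = n := by
      rw [meixnerAtInfinity, neg_neg, natDegree_C_mul (zpow_ne_zero _ hz)]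
      exact natDegree_meixner _ c hd0' hd1' n
    obtain ⟨h1, h2⟩ := natDegree_diffOp_exceptionalCoeff a c ha0 ha1 F₁ F₂ a⁻¹ _ _
      (Or.inr ⟨rfl, rfl, rfl⟩) (meixnerAtInfinity a c (-n)) hne
      (fun f hf => by have := hle f (Finset.mem_union_left _ hf); omega)
      (fun f hf => by have := hle f (Finset.mem_union_right _ hf); omega)
    rw [hdeg] at h2
    refine ⟨h1, ?_⟩
    have := congrArg (Nat.cast (R := ℤ)) h2
    push_cast at this ⊢
    linarith
  have hrec := hb 1 0 _ (isMeixnerSeq_meixner a c ha0 ha1)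
  have hrec' := hb a⁻¹ (-c) _ (isMeixnerSeq_meixnerAtInfinity a c ha0 ha1)
  have hupper : ∀ j, w F₁ F₂ < j → b j = 0 := fun j hj =>
    eq_zero_of_natDegree_lt _ _ _ hχ b 0 lam hrec j (hw ▸ hj)
  -- Reversing the indices turns the lower bound into an upper bound.
  have hlower : ∀ j, j < -w F₁ F₂ → b j = 0 := by
    intro j hj
    set b' : ℤ →₀ ℝ[X] := (b.mapDomain Neg.neg).mapRange (fun p => p.comp (-X)) (zero_comp)
      with hb'
    have hb'j : ∀ i, b' i = (b (-i)).comp (-X) := by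
      intro i
      rw [hb', Finsupp.mapRange_apply]
      conv_lhs => rw [← neg_neg i]
      rw [Finsupp.mapDomain_apply neg_injective]
    have h := eq_zero_of_natDegree_lt (fun n => D a⁻¹ (meixnerAtInfinity a c (-n))) _ _ hχ' b' c
      lam (fun n => by
        rw [hrec' (-n), hb', Finsupp.sum_mapRange_index (by simp), Finsupp.sum_mapDomain_index
          (by simp) (by intro i p q; rw [add_comp, eval_add, add_smul])]
        refine Finsupp.sum_congr fun i _ => ?_
        rw [eval_comp, eval_neg, eval_X]
        push_cast
        rw [show -((n : ℝ) + c) = -(n : ℝ) + -c by ring, show -(n + -i) = -n + i by ring]) (-j)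
      (by omega)
    rw [hb'j, neg_neg] at h
    have := congrArg (fun p => p.comp (-X)) h
    simpa [comp_assoc] using this
  refine ⟨fun j n => (b j).eval ((((n : ℤ) - u F₁ F₂ : ℤ)) : ℝ), ?_, ?_, ?_⟩
  · intro j _
    refine ⟨(b j).comp (X - C (u F₁ F₂ : ℝ)), 1, fun n => ⟨by simp, ?_⟩⟩
    simp [eval_comp]
  · intro n
    rw [exceptional_eq, hrec, Finsupp.sum]
    symm
    refine (Finset.sum_congr rfl fun j _ => ?_).trans
      (Finset.sum_subset (fun j hj => ?_) fun j _ hj => ?_)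
    · rw [exceptional_eq, smul_eq_C_mul, add_zero, sub_add_eq_add_sub]
    · rw [Finset.mem_Icc]
      by_contra hj'
      apply Finsupp.mem_support_iff.mp hj
      by_cases h : j < -w F₁ F₂
      · exact hlower j h
      · exact hupper j (by omega)
    · simp [Finsupp.notMem_support_iff.mp hj]
  · have hlam0 : lam ≠ 0 := by
      rintro rfl
      rw [map_zero, sub_zero, ← casoratian_eq] at hΔ
      exact mul_ne_zero (C_ne_zero.mpr hκ)
        (fun h => hΩ (taylor_injective 1 (h.trans (map_zero _).symm))) hΔ.symm
    obtain ⟨N, hN⟩ := exists_eval_ne_zero _ _ _ hχ b 0 lam hlam0 hrec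
    filter_upwards [Filter.eventually_ge_atTop (N + u F₁ F₂).toNat] with n hn
    have := hN ((n : ℤ) - u F₁ F₂) (by omega)
    rwa [add_zero, hw] at this
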